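/- **Conventions.** A linear code of length $n$ over a finite field $\mathbb F$ is a subspace of $\mathbb F^n$; for a matrix $H$, the code with parity check matrix $H$ is $\ker H$; $\mathcal C|_S$ denotes the restriction of $\mathcal C$ to the coordinates in $S$. A code $\mathcal C$ has $(r,\delta)_a$-locality if every coordinate lies in an $(r,\delta)$-repair set, i.e. a set $S$ of coordinates with $|S|\le r+\delta-1$ such that $\mathcal C|_S$ has minimum distance at least $\delta$. An $[n,k]$ code with $(r,\delta)_a$-locality is an $(n,r,h,\delta,Q)$-MR (maximally recoverable) code, $Q=|\mathbb F|$, if its coordinates are partitioned into $(r,\delta)$-repair sets of size $r+\delta-1$ such that deleting any $\delta-1$ coordinates from every repair set leaves an MDS code, and $h=\frac{n}{r+\delta-1}r-k$. Let $d_{\mathrm{opt}}(n,k,r,\delta)$ be the largest minimum distance of an $[n,k]$ code over $\mathbb F$ with $(r,\delta)_a$-locality. A $(t,1)$ locally repairable convertible code (LRCC) with parameters $(n_I,k_I,r,\delta;n_F,k_F,r,\delta)_a$, where $k_F=tk_I$, consists of initial $[n_I,k_I]$ codes $\mathcal C_1,\dots,\mathcal C_t$ and a final $[n_F,k_F]$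 code $\mathcal C_F$, all with $(r,\delta)_a$-locality, sets $U_i$ (unchanged) and $D_i$ (read) of coordinates of $\mathcal C_i$, and a conversion procedure: the codewords of $\mathcal C_F$ are exactly the vectors obtained from arbitrary $c_i\in\mathcal C_i$ by keeping the symbols $c_i|_{U_i}$, at fixed distinct places, and writing in all other places symbols computed from $c_1|_{D_1},\dots,c_t|_{D_t}$. Its read and write access costs are $\rho_r=\sum_i|D_i|$ and $\rho_w=n_F-\sum_i|U_i|$. Put $\phi(k)=(\lceil k/r\rceil-1)(\delta-1)$, so that $d\le n-k+1-\phi(k)$ is the Singleton-type bound for $[n,k,d]$ codes, $k\ge 1$, with $(r,\delta)_a$-locality, and let $d$ be the minimum distance of $\mathcal C_F$ and $\Delta=n_F-2d-(t-1)k_I+2-\phi((t-1)k_I)$. The LRCC is *access-optimal* (with respect to $\phi$) if the Singleton-type bound holds over $\mathbb F$, $d=d_{\mathrm{opt}}(n_F,k_F,r,\delta)=n_F-k_F+1-\phi(k_F)$, $$\rho_w=t\bigl(d+(t-1)k_I-1+\phi((t-1)k_I)\bigr)-(t-1)n_F,$$ and $\rho_r=tk_I$ if $\Delta\le0$ or $d>n_I-k_I+1$,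 and $\rho_r=t\bigl(k_I-\Delta+(\delta-1)\lfloor\frac{\Delta}{r+\delta-1}\rfloor\bigr)$ otherwise. **Base code.** Let $q$ be a prime power, $r,h,m\ge1$ and $\delta\ge2$. Let $\alpha_1,\dots,\alpha_{r+\delta-1}$ be distinct elements of $\mathbb F_q^*$, let $\gamma_1,\dots,\gamma_h$ be a basis of $\mathbb F_{q^h}$ over $\mathbb F_q$, let $\gamma$ be a primitive element of $\mathbb F_{q^h}$, and let $\beta_i=\sum_{j=1}^h\gamma_j\alpha_i^{\delta-2+j}$. Let $P=(\alpha_j^{i})_{0\le i\le\delta-2,\,1\le j\le r+\delta-1}$ and, for $0\le l<m$, let $B_l$ be the $h\times(r+\delta-1)$ matrix with entries $\beta_j^{q^i}\prod_{x=0}^{i-1}(\gamma^{l})^{q^x}$, $0\le i<h$, $1\le j\le r+\delta-1$. For $\mathcal P\subseteq\{0,\dots,m-1\}$ let $H_{\mathcal P}$ be the matrix over $\mathbb F_{q^h}$ with one block of $r+\delta-1$ columns for each $l\in\mathcal P$, whose upper part is block diagonal with all diagonal blocks equal to $P$ and whose lower part consists of the blocks $B_l$, $l\in\mathcal P$. The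 base code is the code with parity check matrix $H=H_{\{0,\dots,m-1\}}$. **Theorem 5.** Assume $q\ge\max\{r+\delta,m+1\}$, $r\mid h$ and $h/r<m$, and let $u\ge1$ divide $m-h/r$. Put $\ell=m-h/r$, $t=\ell/u$, $\mathcal P_i=\{(i-1)u,\dots,iu-1\}$ for $1\le i\le t$, and $\mathcal P=\{\ell,\dots,m-1\}$. Then there is an access-optimal LRCC over $\mathbb F_{q^h}$ with parameters $$\bigl((u+h/r)(r+\delta-1),\,ur,\,r,\,\delta;\;m(r+\delta-1),\,(m-h/r)r,\,r,\,\delta\bigr)_a$$ of the following form: the $i$-th initial code has parity check matrix $H_{\mathcal P_i\cup\mathcal P}$; the final code has parity check matrix $H$; the unchanged symbols of the $i$-th initial code are those in the blocks $\mathcal P_i$, and they are kept in their blocks; the read symbols are in the blocks $\mathcal P$; and the written symbols, in the blocks $\mathcal P$ of the final code, are the sums of the corresponding symbols of the $t$ initial codewords. Moreover, the initial codes are $((u+h/r)(r+\delta-1),r,h,\delta,q^h)$-MR codes and the final code is an $(m(r+\delta-1),r,h,\delta,q^h)$-MR code. -/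

import Mathlib

namespace LRCC

/-! ### Linear codes

A linear code of length `n` is a submodule of `ι → F` with `Fintype.card ι = n`; the finite type `ι`
labels the code symbols. -/

section Codes

variable {F : Type*} [Field F] {ι : Type*} [Fintype ι]

open Classical in
/-- Minimum Hamming distance of a linear code (`⊤` for the zero code). -/
noncomputable def minDist (C : Submodule F (ι → F)) : ℕ∞ :=
  ⨅ c ∈ {c : ι → F | c ∈ C ∧ c ≠ 0}, (hammingNorm c : ℕ∞)

/-- The punctured code `C|_S`, in which only the symbols with label in `S` are kept. -/
def puncture (C : Submodule F (ι → F)) (S : Finset ι) : Submodule F (S → F) :=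
  C.map (LinearMap.funLeft F F (Subtype.val : S → ι))

/-- A (nonzero) code with `d = n - k + 1`. -/
def IsMDS (C : Submodule F (ι → F)) : Prop :=
  minDist C + (Module.finrank F C : ℕ∞) = (Fintype.card ι : ℕ∞) + 1

/-- `S` is an `(r, δ)`-repair set (for each of its elements). -/
def IsRepairSet (C : Submodule F (ι → F)) (r δ : ℕ) (S : Finset ι) : Prop :=
  S.card ≤ r + δ - 1 ∧ (δ : ℕ∞) ≤ minDist (puncture C S)

/-- All symbol `(r, δ)`-locality. -/
def HasLocality (C : Submodule F (ι → F)) (r δ : ℕ) : Prop :=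
  ∀ i : ι, ∃ S : Finset ι, i ∈ S ∧ IsRepairSet C r δ S

open Classical in
/-- `C` is an `(n, r, h, δ, q)`-MR code, where `n` is its length and `q` is the size of the field:
the repair sets form a partition into sets of size `r + δ - 1`, deleting any `δ - 1` symbols from
every repair set leaves an MDS code, and `h = m r - k` for the number `m` of repair sets. -/
def IsMRCode (C : Submodule F (ι → F)) (r h δ : ℕ) : Prop :=
  ∃ S : Finpartition (Finset.univ : Finset ι),
    (∀ s ∈ S.parts, IsRepairSet C r δ s) ∧
    (∀ R : Finset ι → Finset ι,
      (∀ s ∈ S.parts, R s ⊆ s ∧ (s \ R s).card = δ - 1) →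
        IsMDS (puncture C (S.parts.biUnion R))) ∧
    (∀ s ∈ S.parts, s.card = r + δ - 1) ∧
    Module.finrank F C + h = S.parts.card * r

/-- The largest minimum distance of an `[n, k]` code over `F` with all symbol
`(r, δ)`-locality. -/
noncomputable def dOpt (F : Type*) [Field F] (n k r δ : ℕ) : ℕ∞ :=
  sSup {d | ∃ C : Submodule F (Fin n → F),
    Module.finrank F C = k ∧ HasLocality C r δ ∧ minDist C = d}

/-- `φ(k) = (⌈k / r⌉ - 1)(δ - 1)`, the quantity for which the Singleton-type bound on the distance
of codes with `(r, δ)`-locality reads `d ≤ n - k + 1 - φ(k)`. -/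
def singletonDefect (r δ k : ℕ) : ℤ :=
  (⌈(k : ℚ) / (r : ℚ)⌉ - 1) * ((δ : ℤ) - 1)

/-- `φ` describes the optimal distance of codes with `(r, δ)`-locality over `F`: the value
`n - k + 1 - φ(k)` is never exceeded, and it is the optimal distance for the parameters
`[n₀, k₀]`. -/
def IsDistanceDefect (F : Type*) [Field F] (r δ n₀ k₀ : ℕ) (φ : ℕ → ℤ) : Prop :=
  (∀ (n k d : ℕ) (C : Submodule F (Fin n → F)), 0 < k → Module.finrank F C = k →
    HasLocality C r δ → minDist C = d → (d : ℤ) ≤ n - k + 1 - φ k) ∧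
  ∃ d : ℕ, dOpt F n₀ k₀ r δ = d ∧ (d : ℤ) = n₀ - k₀ + 1 - φ k₀

end Codes

/-! ### Convertible codes in the merge regime -/

/-- A `(t, 1)` convertible code over `F`: `t` initial codes, whose symbols are labelled by the
types `ι i`, a final code, whose symbols are labelled by `κ`, and a conversion procedure. The
unchanged symbols of the initial codes are kept, at the places in the final code that `place`
gives; every other symbol of the final code is written, and is computed by `convert` from the
symbols that are read. -/
structure ConvertibleCode (F : Type*) [Field F] {t : ℕ} (ι : Fin t → Type*)
    [∀ i, Fintype (ι i)] (κ : Type*) [Fintype κ] where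
  /-- the initial codes -/
  initial : ∀ i, Submodule F (ι i → F)
  /-- the final code -/
  final : Submodule F (κ → F)
  /-- the dimensions add up -/
  finrank_eq : ∑ i, Module.finrank F (initial i) = Module.finrank F final
  /-- labels of the unchanged symbols -/
  unchanged : ∀ i, Finset (ι i)
  /-- labels of the symbols that are read -/
  read : ∀ i, Finset (ι i)
  /-- where the unchanged symbols stand in the final code -/
  place : (Σ i, unchanged i) ↪ κ
  /-- the function that computes the written symbols from the read symbols -/
  convert : (∀ i, read i → F) → ({w : κ // w ∉ Set.range place} → F)
  /-- the final code consists of the results of the conversion -/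
  mem_final_iff : ∀ v : κ → F, v ∈ final ↔
    ∃ c : ∀ i, ι i → F, (∀ i, c i ∈ initial i) ∧
      (∀ x, v (place x) = c x.1 x.2) ∧
      ∀ w : {w : κ // w ∉ Set.range place}, v w = convert (fun i a => c i a) w

namespace ConvertibleCode

variable {F : Type*} [Field F] {t : ℕ} {ι : Fin t → Type*} [∀ i, Fintype (ι i)]
  {κ : Type*} [Fintype κ]

/-- Read access cost: the number of symbols that are read. -/
def readCost (𝒞 : ConvertibleCode F ι κ) : ℤ :=
  ∑ i, ((𝒞.read i).card : ℤ)

/-- Write access cost: the number of symbols that are written. -/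
def writeCost (𝒞 : ConvertibleCode F ι κ) : ℤ :=
  (Fintype.card κ : ℤ) - ∑ i, ((𝒞.unchanged i).card : ℤ)

/-- A locally repairable convertible code with parameters
`(nI, kI, rI, δI; nF, kF, rF, δF)_a`. -/
structure HasParameters (𝒞 : ConvertibleCode F ι κ) (nI kI rI δI nF kF rF δF : ℕ) : Prop where
  card_initial : ∀ i, Fintype.card (ι i) = nI
  finrank_initial : ∀ i, Module.finrank F (𝒞.initial i) = kI
  locality_initial : ∀ i, HasLocality (𝒞.initial i) rI δI
  card_final : Fintype.card κ = nF
  finrank_final : Module.finrank F 𝒞.final = kF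
  locality_final : HasLocality 𝒞.final rF δF

end ConvertibleCode

/-- Lower bound on the write access cost of a `(t, 1)` convertible code with parameters
`(nI, k, *, *; nF, tk, r, δ)_a` and final distance `d`. -/
def writeBound (t k nF d : ℕ) (φ : ℕ → ℤ) : ℤ :=
  t * (d + ((t : ℤ) - 1) * k - 1 + φ ((t - 1) * k)) - ((t : ℤ) - 1) * nF

/-- The quantity `Δ` in the lower bound on the read access cost. -/
def readDelta (t k nF d : ℕ) (φ : ℕ → ℤ) : ℤ :=
  nF - 2 * d - ((t : ℤ) - 1) * k + 2 - φ ((t - 1) * k)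

/-- Lower bound on the read access cost of a `(t, 1)` convertible code with parameters
`(nI, k, *, *; nF, tk, r, δ)_a` and final distance `d`. -/
def readBound (t nI k nF d r δ : ℕ) (φ : ℕ → ℤ) : ℤ :=
  if readDelta t k nF d φ ≤ 0 ∨ (d : ℤ) > nI - k + 1 then (t : ℤ) * k
  else t * (k - readDelta t k nF d φ
    + ((δ : ℤ) - 1) * ⌊(readDelta t k nF d φ : ℚ) / ((r : ℚ) + δ - 1)⌋)

/-- A `(t, 1)` convertible code with parameters `(nI, k, *, *; nF, tk, r, δ)_a` is access-optimal:
read and write access cost both achieve their lower bounds, in which `φ` is the quantity that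
describes the optimal distance `n - k + 1 - φ(k)`, and the final code has the optimal distance. -/
def IsAccessOptimal {F : Type*} [Field F] {t : ℕ} {ι : Fin t → Type*} [∀ i, Fintype (ι i)]
    {κ : Type*} [Fintype κ] (𝒞 : ConvertibleCode F ι κ) (nI k nF r δ : ℕ) (φ : ℕ → ℤ) : Prop :=
  IsDistanceDefect F r δ nF (t * k) φ ∧
  ∃ d : ℕ, minDist 𝒞.final = d ∧ dOpt F nF (t * k) r δ = d ∧
    𝒞.readCost = readBound t nI k nF d r δ φ ∧
    𝒞.writeCost = writeBound t k nF d φ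

/-! ### The general construction -/

section Construction

variable {F : Type*} [Field F]

/-- The matrix with diagonal blocks `A l` above the blocks `B l`. For `P` a set of block labels,
`H||_P` is the block matrix of the blocks with label in `P`. -/
def blockMatrix {β a b n : Type*} [DecidableEq β] (A : β → Matrix a n F) (B : β → Matrix b n F) :
    Matrix ((β × a) ⊕ b) (β × n) F :=
  Matrix.of fun i x => Sum.elim (fun p => if p.1 = x.1 then A x.1 p.2 x.2 else 0)
    (fun p => B x.1 p x.2) i

/-- The linear code with parity check matrix `H`. -/
def codeOf {ρ ν : Type*} [Fintype ν] (H : Matrix ρ ν F) : Submodule F (ν → F) :=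
  LinearMap.ker H.mulVecLin

/-- The `i`-th group of `s` consecutive block labels. -/
def group (g s i : ℕ) : Finset (Fin g) :=
  Finset.univ.filter fun l => i * s ≤ (l : ℕ) ∧ (l : ℕ) < (i + 1) * s

/-- The common block labels, from `ℓ` on. -/
def tail (g ℓ : ℕ) : Finset (Fin g) :=
  Finset.univ.filter fun l => ℓ ≤ (l : ℕ)

/-- Labels of the symbols of the `i`-th initial code. -/
abbrev InitialIndex (g s ℓ n i : ℕ) : Type :=
  {l : Fin g // l ∈ group g s i ∪ tail g ℓ} × Fin n

/-- The convertible code given by the general construction (final code of the same length as the base code) from the base code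
with parity check matrix `blockMatrix A B`, which has `g` blocks of `n` columns. The first `ℓ`
blocks are divided into `t` groups of `s` blocks, and the last `g - ℓ` blocks belong to all initial
codes. The blocks of the groups are unchanged, symbols of the common blocks are read, and the
common blocks of the final codeword are the sums of those of the initial codewords. -/
structure IsMergeConstruction {g ℓ s t n a b : ℕ} (A : Fin g → Matrix (Fin a) (Fin n) F)
    (B : Fin g → Matrix (Fin b) (Fin n) F)
    (𝒞 : ConvertibleCode F (fun i : Fin t => InitialIndex g s ℓ n i) (Fin g × Fin n)) : Prop where
  initial_eq : ∀ i, 𝒞.initial i = codeOf (blockMatrix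
    (fun l : {l : Fin g // l ∈ group g s i ∪ tail g ℓ} => A l) (fun l => B l))
  final_eq : 𝒞.final = codeOf (blockMatrix A B)
  unchanged_eq : ∀ i x, x ∈ 𝒞.unchanged i ↔ (x.1 : Fin g) ∈ group g s i
  place_eq : ∀ x, 𝒞.place x =
    ((x.2 : InitialIndex g s ℓ n x.1).1.1, (x.2 : InitialIndex g s ℓ n x.1).2)
  read_subset : ∀ i, ∀ x ∈ 𝒞.read i, (x.1 : Fin g) ∈ tail g ℓ
  convert_eq : ∀ c : ∀ i : Fin t, InitialIndex g s ℓ n i → F, (∀ i, c i ∈ 𝒞.initial i) →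
    ∀ (w : {w // w ∉ Set.range 𝒞.place}) (hw : w.1.1 ∈ tail g ℓ),
      𝒞.convert (fun i x => c i x) w =
        ∑ i, c i (⟨w.1.1, Finset.mem_union_right _ hw⟩, w.1.2)

end Construction

/-! ### The base code, from linearized Reed–Solomon codes -/

section BaseCode

variable {K L : Type*} [Field K] [Field L] [Algebra K L]

/-- The operator `𝒟_a^i(β) = β^(q^i) ∏_{j < i} a^(q^j)`. -/
def skewOp (q : ℕ) (a : L) (i : ℕ) (β : L) : L :=
  β ^ q ^ i * ∏ j ∈ Finset.range i, a ^ q ^ j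

/-- The local blocks `P`: the Vandermonde matrix with rows `α_j^0, …, α_j^(δ-2)`. -/
def baseP (L : Type*) [Field L] [Algebra K L] {N : ℕ} (δ : ℕ) (α : Fin N → K) :
    Matrix (Fin (δ - 1)) (Fin N) L :=
  Matrix.of fun i j => algebraMap K L (α j) ^ (i : ℕ)

/-- `β_i = ∑_j γ_j α_i^(δ-2+j)`; the index `j` starts at `1` in this formula and at `0` below. -/
def baseBeta {N h : ℕ} (δ : ℕ) (α : Fin N → K) (b : Fin h → L) (i : Fin N) : L :=
  ∑ j : Fin h, b j * algebraMap K L (α i) ^ (δ - 1 + (j : ℕ))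

/-- The block `D(a, β, h, N)`, with the entries `𝒟_a^i(β_j)`, `0 ≤ i < h`. -/
def baseD {N : ℕ} (q h : ℕ) (a : L) (β : Fin N → L) : Matrix (Fin h) (Fin N) L :=
  Matrix.of fun i j => skewOp q a i (β j)

end BaseCode

end LRCC

/-! Put `s = h / r` and `N = r + δ - 1`. Everything rests on one property of a code made of blocks
of length `N`, `IsBlockGeneric`: fewer than `δ` erasures in a block can be corrected inside that
block, and `δ - 1` erasures in every block together with any `h` further ones can be corrected
globally.

The base code has this property. If a set `E` of `δ - 1` positions of a block is erased, the local
Vandermonde checks replace each `β_j` in the global checks by its interpolation error on `E`. The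
errors vanish on `E`, and any `h` of them off `E` are linearly independent over `K`, because the
coordinates of `β_j` are the powers of `α_j` that follow those in the local checks
(`eq_zero_of_sum_smul_interpolationError_eq_zero`). What remains is a linearized Reed–Solomon parity
check matrix whose parameters `γ^l` lie in different conjugacy classes, so any `h` of its columns
are independent (`eq_zero_of_sum_mul_skewOp_eq_zero`, `baseCode_eq_zero`). The same argument covers
every subfamily of blocks, hence the initial codes.

The property yields the dimension, the locality, maximal recoverability and the distance bound `s *
N + δ`, which meets the Singleton-type bound. For the conversion, initial codewords extended by zero
satisfy all checks of the final code, and so do their sums. An initial codeword is determined by its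
group of `u` blocks, so the sum map is injective, and by equality of dimensions it is onto the final
code (`mem_codeOf_iff_exists_mergeSum`). The common blocks of an initial codeword are determined by
`min u s * r` of their symbols (`exists_read_set`), which is exactly what the read bound allows; the
written symbols are those of `s` blocks, as in the write bound. -/

namespace LRCC

/-! ### Distance, shortening and the Singleton-type bound for codes with locality. -/

section GeneralCodes

variable {F : Type*} [Field F] {ι : Type*} [Fintype ι]

open Module

set_option linter.unusedSectionVars false

/-- Distance as erasure correction. All later distance arguments use this form, which also covers
the zero code. -/
theorem natCast_le_minDist_iff {C : Submodule F (ι → F)} {d : ℕ} :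
    (d : ℕ∞) ≤ minDist C ↔
      ∀ c ∈ C, ∀ S : Finset ι, S.card < d → (∀ i ∉ S, c i = 0) → c = 0 := by
  classical
  unfold minDist
  simp only [le_iInf_iff, Set.mem_ofPred_eq, Nat.cast_le, and_imp]
  constructor
  · intro H c hc S hS hcS
    by_contra h0
    have h1 := H c hc h0
    have h2 : hammingNorm c ≤ S.card := by
      unfold hammingNorm
      refine Finset.card_le_card fun i hi => ?_
      by_contra hiS
      exact (Finset.mem_filter.1 hi).2 (hcS i hiS)
    have h3 : d ≤ hammingNorm c := by convert h1
    omega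
  · intro H c hc h0
    by_contra hlt
    refine h0 (H c hc (Finset.univ.filter fun i => c i ≠ 0) ?_ ?_)
    · have h3 : ¬ d ≤ hammingNorm c := by convert hlt
      unfold hammingNorm at h3
      omega
    · intro i hi
      simpa using hi

theorem natCast_le_minDist_puncture_iff {C : Submodule F (ι → F)} {d : ℕ} {S : Finset ι} :
    (d : ℕ∞) ≤ minDist (puncture C S) ↔
      ∀ c ∈ C, ∀ T ⊆ S, T.card < d → (∀ i ∈ S, i ∉ T → c i = 0) → ∀ i ∈ S, c i = 0 := by
  classical
  rw [natCast_le_minDist_iff]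
  constructor
  · intro H c hc T hTS hT hcT i hi
    have := H (LinearMap.funLeft F F (Subtype.val : S → ι) c) (Submodule.mem_map_of_mem hc)
      (T.subtype (· ∈ S)) (by
        rw [Finset.card_subtype]
        exact (Finset.card_filter_le _ _).trans_lt hT) (by
        rintro ⟨j, hj⟩ hjT
        simp only [Finset.mem_subtype] at hjT
        exact hcT j hj hjT)
    exact congrFun this ⟨i, hi⟩
  · rintro H _ ⟨c, hc, rfl⟩ T hT hcT
    ext ⟨i, hi⟩
    refine H c hc (T.map (Function.Embedding.subtype _)) ?_ (by simpa using hT) ?_ i hi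
    · intro j hj
      obtain ⟨⟨x, hx⟩, -, rfl⟩ := Finset.mem_map.1 hj
      exact hx
    · intro j hj hjT
      refine hcT ⟨j, hj⟩ fun hjm => hjT (Finset.mem_map.2 ⟨_, hjm, rfl⟩)

/-- The codewords that vanish on `S`. -/
def vanishingOn (C : Submodule F (ι → F)) (S : Finset ι) : Submodule F (ι → F) where
  carrier := {c | c ∈ C ∧ ∀ i ∈ S, c i = 0}
  add_mem' := fun {x y} hx hy => ⟨C.add_mem hx.1 hy.1, fun i hi => by
    simp [hx.2 i hi, hy.2 i hi]⟩
  zero_mem' := ⟨C.zero_mem, fun _ _ => rfl⟩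
  smul_mem' := fun a x hx => ⟨C.smul_mem a hx.1, fun i hi => by simp [hx.2 i hi]⟩

theorem mem_vanishingOn {C : Submodule F (ι → F)} {S : Finset ι} {c : ι → F} :
    c ∈ vanishingOn C S ↔ c ∈ C ∧ ∀ i ∈ S, c i = 0 := Iff.rfl

@[simp] theorem vanishingOn_empty (C : Submodule F (ι → F)) : vanishingOn C ∅ = C := by
  ext; simp [mem_vanishingOn]

theorem vanishingOn_vanishingOn [DecidableEq ι] (C : Submodule F (ι → F)) (S T : Finset ι) :
    vanishingOn (vanishingOn C S) T = vanishingOn C (S ∪ T) := by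
  ext
  simp only [mem_vanishingOn, Finset.mem_union, or_imp, forall_and, and_assoc]

theorem finrank_le_finrank_vanishingOn_add_card (C : Submodule F (ι → F)) (S : Finset ι) :
    finrank F C ≤ finrank F (vanishingOn C S) + S.card := by
  let f : C →ₗ[F] (S → F) := (LinearMap.funLeft F F (Subtype.val : S → ι)).comp C.subtype
  have h1 := LinearMap.finrank_range_add_finrank_ker f
  have h2 : finrank F (LinearMap.range f) ≤ S.card := by
    simpa using Submodule.finrank_le (LinearMap.range f)
  have h3 : finrank F (LinearMap.ker f) ≤ finrank F (vanishingOn C S) := by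
    rw [← Submodule.finrank_map_subtype_eq]
    refine Submodule.finrank_mono ?_
    rintro _ ⟨⟨x, hx⟩, hxk, rfl⟩
    exact ⟨hx, fun i hi => congrFun (LinearMap.mem_ker.1 hxk) ⟨i, hi⟩⟩
  omega

theorem finrank_vanishingOn_le_add_card [DecidableEq ι] (C : Submodule F (ι → F))
    (S T : Finset ι) :
    finrank F (vanishingOn C S) ≤ finrank F (vanishingOn C (S ∪ T)) + T.card := by
  rw [← vanishingOn_vanishingOn]
  exact finrank_le_finrank_vanishingOn_add_card _ _

theorem finrank_puncture_of_forall_eq_zero {C : Submodule F (ι → F)} {S : Finset ι}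
    (h : ∀ c ∈ C, (∀ i ∈ S, c i = 0) → c = 0) :
    finrank F (puncture C S) = finrank F C := by
  have hinj : Function.Injective
      ((LinearMap.funLeft F F (Subtype.val : S → ι)).domRestrict C) := by
    rw [← LinearMap.ker_eq_bot, LinearMap.ker_eq_bot']
    rintro ⟨c, hc⟩ h0
    exact Subtype.ext (h c hc fun i hi => congrFun h0 ⟨i, hi⟩)
  rw [← LinearMap.finrank_range_of_inj hinj, LinearMap.range_domRestrict]
  rfl

/-- Singleton bound for the shortened code: forcing one zero fewer than its dimension, at places
outside `S`, leaves a nonzero codeword that also vanishes on `S`. -/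
theorem add_card_add_finrank_vanishingOn_le {C : Submodule F (ι → F)} {d : ℕ}
    (hd : (d : ℕ∞) ≤ minDist C) (S : Finset ι) (hS : 0 < finrank F (vanishingOn C S)) :
    d + S.card + finrank F (vanishingOn C S) ≤ Fintype.card ι + 1 := by
  classical
  have hcompl : finrank F (vanishingOn C S) ≤ Sᶜ.card := by
    have h := finrank_vanishingOn_le_add_card C S Sᶜ
    have h0 : vanishingOn C (S ∪ Sᶜ) = ⊥ := by
      rw [eq_bot_iff]
      intro c hc
      ext i
      exact hc.2 i (by simp)
    rw [h0, finrank_bot] at h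
    omega
  obtain ⟨T, hTS, hT⟩ := Finset.exists_subset_card_eq
    (show finrank F (vanishingOn C S) - 1 ≤ Sᶜ.card by omega)
  have h := finrank_vanishingOn_le_add_card C S T
  have hpos : 0 < finrank F (vanishingOn C (S ∪ T)) := by omega
  have hne : vanishingOn C (S ∪ T) ≠ ⊥ := by
    intro h0
    rw [h0, finrank_bot] at hpos
    exact hpos.false
  obtain ⟨c, hc, hc0⟩ := Submodule.exists_mem_ne_zero_of_ne_bot hne
  have hcard : (S ∪ T).card = S.card + T.card :=
    Finset.card_union_of_disjoint (Finset.disjoint_left.2 fun i hi hiT =>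
      Finset.mem_compl.1 (hTS hiT) hi)
  have hle : d ≤ (S ∪ T)ᶜ.card := by
    by_contra hlt
    refine hc0 (natCast_le_minDist_iff.1 hd c hc.1 (S ∪ T)ᶜ (by omega) fun i hi => ?_)
    exact hc.2 i (not_not.1 fun h => hi (Finset.mem_compl.2 h))
  rw [Finset.card_compl] at hle
  have := Finset.card_le_univ (S ∪ T)
  omega

/-- The Singleton bound. -/
theorem add_finrank_le_of_le_minDist {C : Submodule F (ι → F)} {d : ℕ}
    (hd : (d : ℕ∞) ≤ minDist C) (hC : 0 < finrank F C) :
    d + finrank F C ≤ Fintype.card ι + 1 := by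
  have := add_card_add_finrank_vanishingOn_le hd ∅ (by rwa [vanishingOn_empty])
  rwa [vanishingOn_empty, Finset.card_empty, add_zero] at this

theorem minDist_eq_of_forall_le {C : Submodule F (ι → F)} {d : ℕ} (hd : (d : ℕ∞) ≤ minDist C)
    (h : ∀ e : ℕ, (e : ℕ∞) ≤ minDist C → e ≤ d) : minDist C = d := by
  refine le_antisymm ?_ hd
  induction hm : minDist C using ENat.recTopCoe with
  | top => exact absurd (h (d + 1) (by rw [hm]; exact le_top)) (by omega)
  | coe e => exact_mod_cast h e hm.ge

theorem isMDS_of_le_minDist {C : Submodule F (ι → F)} {e : ℕ} (he : ((e + 1 : ℕ) : ℕ∞) ≤ minDist C)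
    (hC : 0 < finrank F C) (hcard : finrank F C + e = Fintype.card ι) : IsMDS C := by
  have h : minDist C = ((e + 1 : ℕ) : ℕ∞) := minDist_eq_of_forall_le he fun e' he' => by
    have := add_finrank_le_of_le_minDist he' hC
    omega
  unfold IsMDS
  rw [h, ← hcard]
  push_cast
  ring

/-- Add to `S` a repair set `Γ` on which some codeword vanishing on `S` is nonzero. Then `Γ \ S` has
at least `δ` elements, and `δ - 1` of them cost no dimension because they are recovered from the
rest of `Γ`. So the dimension drops by at most `r`, and the sum of cardinality and dimension gains
`δ - 1`. Iterating this step gives the Singleton-type bound. -/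
theorem exists_card_add_finrank_vanishingOn_step [DecidableEq ι] {C : Submodule F (ι → F)}
    {r δ : ℕ} (hδ : 1 ≤ δ) (hloc : HasLocality C r δ) (S : Finset ι)
    (hS : 0 < finrank F (vanishingOn C S)) :
    ∃ S' : Finset ι,
      S.card + finrank F (vanishingOn C S) + (δ - 1) ≤ S'.card + finrank F (vanishingOn C S') ∧
      finrank F (vanishingOn C S) ≤ finrank F (vanishingOn C S') + r := by
  have hne : vanishingOn C S ≠ ⊥ := by
    intro h0
    rw [h0, finrank_bot] at hS
    exact hS.false
  obtain ⟨c, hc, hc0⟩ := Submodule.exists_mem_ne_zero_of_ne_bot hne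
  obtain ⟨i, hi⟩ := Function.ne_iff.1 hc0
  obtain ⟨Γ, hiΓ, hΓ, hdist⟩ := hloc i
  rw [natCast_le_minDist_puncture_iff] at hdist
  have hδΓ : δ ≤ (Γ \ S).card := by
    by_contra hlt
    refine hi (hdist c hc.1 (Γ \ S) Finset.sdiff_subset (by omega) (fun j hj hjS => ?_) i hiΓ)
    refine hc.2 j ?_
    by_contra hjS'
    exact hjS (Finset.mem_sdiff.2 ⟨hj, hjS'⟩)
  obtain ⟨D, hD, hDcard⟩ := Finset.exists_subset_card_eq (show δ - 1 ≤ (Γ \ S).card by omega)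
  have heq : vanishingOn C (S ∪ ((Γ \ S) \ D)) ≤ vanishingOn C (S ∪ Γ) := by
    rintro x ⟨hx, hx0⟩
    have hΓ0 : ∀ j ∈ Γ, x j = 0 := hdist x hx D (hD.trans Finset.sdiff_subset) (by omega)
      fun j hj hjD => hx0 j (by
        by_cases hjS : j ∈ S <;> simp [hj, hjD, hjS])
    refine ⟨hx, fun j hj => ?_⟩
    rcases Finset.mem_union.1 hj with hj | hj
    · exact hx0 j (Finset.mem_union_left _ hj)
    · exact hΓ0 j hj
  have h1 := Submodule.finrank_mono heq
  have h2 := finrank_vanishingOn_le_add_card C S ((Γ \ S) \ D)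
  have h3 : ((Γ \ S) \ D).card = (Γ \ S).card - (δ - 1) := by
    rw [Finset.card_sdiff_of_subset hD, hDcard]
  have h4 : (S ∪ Γ).card = S.card + (Γ \ S).card := by
    rw [← Finset.card_union_of_disjoint Finset.disjoint_sdiff, Finset.union_sdiff_self_eq_union]
  have h5 : (Γ \ S).card ≤ Γ.card := Finset.card_le_card Finset.sdiff_subset
  exact ⟨S ∪ Γ, by omega, by omega⟩

theorem exists_card_add_finrank_vanishingOn {C : Submodule F (ι → F)}
    {r δ : ℕ} (hδ : 1 ≤ δ) (hloc : HasLocality C r δ) (j : ℕ) (hj : j * r < finrank F C) :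
    ∃ S : Finset ι,
      finrank F C + j * (δ - 1) ≤ S.card + finrank F (vanishingOn C S) ∧
      finrank F C ≤ finrank F (vanishingOn C S) + j * r := by
  classical
  induction j with
  | zero => exact ⟨∅, by rw [vanishingOn_empty]; omega, by rw [vanishingOn_empty]; omega⟩
  | succ j ih =>
    rw [add_one_mul] at hj
    obtain ⟨S, h1, h2⟩ := ih (by omega)
    obtain ⟨S', h3, h4⟩ := exists_card_add_finrank_vanishingOn_step hδ hloc S (by omega)
    exact ⟨S', by rw [add_one_mul]; omega, by rw [add_one_mul]; omega⟩

/-- The Singleton-type bound for codes with locality. -/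
theorem add_finrank_add_mul_le_of_hasLocality {C : Submodule F (ι → F)} {r δ d : ℕ} (hδ : 1 ≤ δ)
    (hloc : HasLocality C r δ) (hd : (d : ℕ∞) ≤ minDist C) (j : ℕ) (hj : j * r < finrank F C) :
    d + finrank F C + j * (δ - 1) ≤ Fintype.card ι + 1 := by
  obtain ⟨S, h1, h2⟩ := exists_card_add_finrank_vanishingOn hδ hloc j hj
  have := add_card_add_finrank_vanishingOn_le hd S (by omega)
  omega

theorem le_sub_singletonDefect_of_hasLocality {C : Submodule F (ι → F)} {r δ d : ℕ} (hr : 1 ≤ r)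
    (hδ : 1 ≤ δ) (hloc : HasLocality C r δ) (hd : (d : ℕ∞) ≤ minDist C) (hC : 0 < finrank F C) :
    (d : ℤ) ≤ Fintype.card ι - finrank F C + 1 - singletonDefect r δ (finrank F C) := by
  set k := finrank F C with hk
  have hr0 : (0 : ℚ) < r := by exact_mod_cast hr
  have hpos : 0 < ⌈(k : ℚ) / (r : ℚ)⌉ := Int.ceil_pos.2 (by positivity)
  -- This `j` is the largest number of steps with `j * r < k`.
  obtain ⟨j, hj⟩ : ∃ j : ℕ, ⌈(k : ℚ) / (r : ℚ)⌉ = j + 1 :=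
    ⟨(⌈(k : ℚ) / (r : ℚ)⌉ - 1).toNat, by omega⟩
  have hlt : (j : ℚ) < (k : ℚ) / r := by
    have := Int.ceil_lt_add_one ((k : ℚ) / r)
    rw [hj] at this
    push_cast at this
    linarith
  have hjr : j * r < k := by
    rw [lt_div_iff₀ hr0] at hlt
    exact_mod_cast hlt
  have h := add_finrank_add_mul_le_of_hasLocality hδ hloc hd j hjr
  unfold singletonDefect
  rw [hj]
  have h' : (d : ℤ) + k + j * ((δ : ℤ) - 1) ≤ Fintype.card ι + 1 := by
    have : (((δ - 1 : ℕ) : ℤ)) = (δ : ℤ) - 1 := by omega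
    rw [← this]
    exact_mod_cast h
  linarith

/-- The case `k = 0`, with the value `-(δ - 1)`, is included; it occurs in the cost bounds when `t =
1`. -/
theorem singletonDefect_mul {r : ℕ} (hr : 1 ≤ r) (δ k : ℕ) :
    singletonDefect r δ (k * r) = ((k : ℤ) - 1) * ((δ : ℤ) - 1) := by
  have hr0 : (r : ℚ) ≠ 0 := by exact_mod_cast (show r ≠ 0 by omega)
  unfold singletonDefect
  rw [Nat.cast_mul, mul_div_cancel_right₀ _ hr0, Int.ceil_natCast]

/-! ### Relabelling of code symbols. -/

section Reindex

variable {κ : Type*} [Fintype κ] (e : κ ≃ ι) (C : Submodule F (ι → F))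

/-- The code `C` with its symbols relabelled along `e`. -/
def reindex : Submodule F (κ → F) :=
  C.map (LinearEquiv.funCongrLeft F F e).toLinearMap

theorem mem_reindex {x : κ → F} : x ∈ reindex e C ↔ ∃ c ∈ C, ∀ k, x k = c (e k) := by
  constructor
  · rintro ⟨c, hc, rfl⟩
    exact ⟨c, hc, fun _ => rfl⟩
  · rintro ⟨c, hc, h⟩
    exact ⟨c, hc, (funext h).symm⟩

theorem finrank_reindex : finrank F (reindex e C) = finrank F C :=
  LinearEquiv.finrank_map_eq _ _

theorem natCast_le_minDist_reindex {d : ℕ} (hd : (d : ℕ∞) ≤ minDist C) :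
    (d : ℕ∞) ≤ minDist (reindex e C) := by
  rw [natCast_le_minDist_iff] at hd ⊢
  intro x hx S hS hxS
  obtain ⟨c, hc, hxc⟩ := (mem_reindex e C).1 hx
  have := hd c hc (S.map e.toEmbedding) (by simpa using hS) fun i hi => by
    have := hxS (e.symm i) fun h => hi (Finset.mem_map.2 ⟨_, h, by simp⟩)
    rwa [hxc, e.apply_symm_apply] at this
  ext k
  rw [hxc, this]; rfl

theorem HasLocality.reindex {C : Submodule F (ι → F)} {r δ : ℕ} (h : HasLocality C r δ) :
    HasLocality (reindex e C) r δ := by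
  intro k
  obtain ⟨S, hkS, hS, hdist⟩ := h (e k)
  refine ⟨S.map e.symm.toEmbedding, Finset.mem_map.2 ⟨_, hkS, by simp⟩, by simpa using hS, ?_⟩
  rw [natCast_le_minDist_puncture_iff] at hdist ⊢
  intro x hx T hTS hT hxT
  obtain ⟨c, hc, hxc⟩ := (mem_reindex e C).1 hx
  have h0 := hdist c hc (T.map e.toEmbedding) (fun i hi => by
      obtain ⟨j, hj, rfl⟩ := Finset.mem_map.1 hi
      obtain ⟨l, hl, rfl⟩ := Finset.mem_map.1 (hTS hj)
      simpa using hl) (by simpa using hT) fun i hi hiT => by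
    have := hxT (e.symm i) (Finset.mem_map.2 ⟨_, hi, rfl⟩)
      fun h => hiT (Finset.mem_map.2 ⟨_, h, by simp⟩)
    rwa [hxc, e.apply_symm_apply] at this
  intro j hj
  obtain ⟨l, hl, rfl⟩ := Finset.mem_map.1 hj
  rw [hxc]
  simpa using h0 l hl

end Reindex

theorem le_of_eq_sub_singletonDefect {C : Submodule F (ι → F)} {n k r δ d e : ℕ} (hr : 1 ≤ r)
    (hδ : 1 ≤ δ) (hn : Fintype.card ι = n) (hk : finrank F C = k) (hk0 : 0 < k)
    (hloc : HasLocality C r δ) (hopt : (d : ℤ) = n - k + 1 - singletonDefect r δ k)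
    (he : (e : ℕ∞) ≤ minDist C) : e ≤ d := by
  subst hn hk
  have := le_sub_singletonDefect_of_hasLocality hr hδ hloc he hk0
  rw [← hopt] at this
  exact_mod_cast this

/-- A code that meets the Singleton-type bound has the optimal distance. -/
theorem minDist_eq_and_dOpt_eq {C : Submodule F (ι → F)} {n k r δ d : ℕ} (hr : 1 ≤ r) (hδ : 1 ≤ δ)
    (hn : Fintype.card ι = n) (hk : finrank F C = k) (hk0 : 0 < k) (hloc : HasLocality C r δ)
    (hd : (d : ℕ∞) ≤ minDist C) (hopt : (d : ℤ) = n - k + 1 - singletonDefect r δ k) :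
    minDist C = d ∧ dOpt F n k r δ = d := by
  have key : ∀ e : ℕ, (e : ℕ∞) ≤ minDist C → e ≤ d := fun e =>
    le_of_eq_sub_singletonDefect hr hδ hn hk hk0 hloc hopt
  have key' : ∀ C' : Submodule F (Fin n → F), finrank F C' = k → HasLocality C' r δ →
      ∀ e : ℕ, (e : ℕ∞) ≤ minDist C' → e ≤ d := fun C' hC' hloc' e =>
    le_of_eq_sub_singletonDefect hr hδ (Fintype.card_fin n) hC' hk0 hloc' hopt
  refine ⟨minDist_eq_of_forall_le hd key, le_antisymm (sSup_le ?_) (le_sSup ?_)⟩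
  · rintro _ ⟨C', h1, h2, rfl⟩
    by_contra hlt
    have := key' C' h1 h2 (d + 1) (by
      push_cast
      exact Order.add_one_le_of_lt (not_le.1 hlt))
    omega
  -- `dOpt` ranges over codes labelled by `Fin n`, so the code is transported there.
  · let e := (Fintype.equivFinOfCardEq hn).symm
    have hfin : finrank F (reindex e C) = k := (finrank_reindex e C).trans hk
    exact ⟨reindex e C, hfin, hloc.reindex e, minDist_eq_of_forall_le
      (natCast_le_minDist_reindex e C hd) (key' _ hfin (hloc.reindex e))⟩

theorem isDistanceDefect_singletonDefect {r δ n k d : ℕ} (hr : 1 ≤ r) (hδ : 1 ≤ δ)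
    (hopt : dOpt F n k r δ = d) (hd : (d : ℤ) = n - k + 1 - singletonDefect r δ k) :
    IsDistanceDefect F r δ n k (singletonDefect r δ) := by
  refine ⟨fun n k d C hk hC hloc hd => ?_, d, hopt, hd⟩
  subst hC
  simpa using le_sub_singletonDefect_of_hasLocality hr hδ hloc hd.ge hk

end GeneralCodes

/-! ### Skew operators, conjugacy classes and linearized Reed–Solomon matrices. -/

section SkewOperators

variable {K L : Type*} [Field K] [Field L] [Algebra K L]

@[simp] theorem skewOp_zero (q : ℕ) (a β : L) : skewOp q a 0 β = β := by
  simp [skewOp]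

/-- The operators are the iterates of `β ↦ a * β ^ q`; one application is split off on the inside.
-/
theorem skewOp_succ (q : ℕ) (a : L) (i : ℕ) (β : L) :
    skewOp q a (i + 1) β = skewOp q a i (a * β ^ q) := by
  simp only [skewOp, Finset.prod_range_succ, mul_pow, ← pow_mul, pow_succ, mul_comm q]
  ring

theorem skewOp_mul (q : ℕ) (a : L) (i : ℕ) (c β : L) :
    skewOp q a i (c * β) = c ^ q ^ i * skewOp q a i β := by
  simp only [skewOp, mul_pow, mul_assoc]

variable (K) in
theorem exists_algHom_apply_eq_pow [Finite K] (i : ℕ) :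
    ∃ f : L →ₐ[K] L, ∀ x, f x = x ^ Nat.card K ^ i := by
  have := Fintype.ofFinite K
  refine ⟨FiniteField.frobeniusAlgHom K L ^ i, fun x => ?_⟩
  rw [AlgHom.coe_pow, FiniteField.coe_frobeniusAlgHom, pow_iterate, Nat.card_eq_fintype_card]

variable (K) in
/-- The operator `𝒟_a^i` as a linear map. -/
theorem exists_linearMap_apply_eq_skewOp [Finite K] (a : L) (i : ℕ) :
    ∃ f : L →ₗ[K] L, ∀ x, f x = skewOp (Nat.card K) a i x := by
  obtain ⟨f, hf⟩ := exists_algHom_apply_eq_pow (L := L) K i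
  refine ⟨(LinearMap.mulRight K (∏ j ∈ Finset.range i, a ^ Nat.card K ^ j)).comp f.toLinearMap,
    fun x => ?_⟩
  simp [skewOp, hf]

/-- The elements of `K` already exhaust the possible roots of `X ^ |K| - X`. -/
theorem mem_range_algebraMap_of_pow_card_eq_self [Finite K] {x : L} (hx : x ^ Nat.card K = x) :
    ∃ k : K, algebraMap K L k = x := by
  have := Fintype.ofFinite K
  rw [Nat.card_eq_fintype_card] at hx
  have hq : 1 < Fintype.card K := Fintype.one_lt_card
  by_contra! hne
  have hp0 := FiniteField.X_pow_card_sub_X_ne_zero L hq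
  have hcard := Polynomial.card_le_degree_of_subset_roots
    (p := (Polynomial.X ^ Fintype.card K - Polynomial.X : Polynomial L))
    (Z := Finset.cons x (Finset.univ.map ⟨_, (algebraMap K L).injective⟩) (by
      simpa using hne)) (by
    intro y hy
    rw [Polynomial.mem_roots hp0]
    rw [Finset.mem_val, Finset.mem_cons] at hy
    rcases hy with rfl | hy
    · simp [hx]
    · obtain ⟨k, -, rfl⟩ := Finset.mem_map.1 hy
      simp [← map_pow, FiniteField.pow_card])
  rw [FiniteField.X_pow_card_sub_X_natDegree_eq L hq, Finset.card_cons, Finset.card_map,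
    Finset.card_univ] at hcard
  omega

/-- The columns of a linearized Reed–Solomon parity check matrix are linearly independent. -/
theorem eq_zero_of_sum_mul_skewOp_eq_zero [Finite K] {ι Λ : Type*} (lab : ι → Λ) (a : Λ → L)
    (ha : ∀ l, a l ≠ 0)
    (hconj : ∀ l l' : Λ, ∀ x y : L, x ≠ 0 → y ≠ 0 →
      a l * x ^ (Nat.card K - 1) = a l' * y ^ (Nat.card K - 1) → l = l')
    (s : Finset ι) (η y : ι → L) (n : ℕ) (hn : s.card ≤ n)
    (hη : ∀ l, ∀ g : ι → K, (∀ i, lab i ≠ l → g i = 0) → ∑ i ∈ s, g i • η i = 0 →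
      ∀ i ∈ s, g i = 0)
    (hy : ∀ e < n, ∑ i ∈ s, y i * skewOp (Nat.card K) (a (lab i)) e (η i) = 0) :
    ∀ i ∈ s, y i = 0 := by
  classical
  have hq : 1 < Nat.card K := Finite.one_lt_card
  induction s using Finset.induction_on generalizing η n with
  | empty => simp
  | insert i₀ s hi₀ ih =>
    rw [Finset.card_insert_of_notMem hi₀] at hn
    have hη₀ : η i₀ ≠ 0 := by
      intro h0
      have := hη (lab i₀) (Pi.single i₀ 1) (fun i hi => by
        rw [Pi.single_eq_of_ne]; rintro rfl; exact hi rfl) (by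
          refine Finset.sum_eq_zero fun i _ => ?_
          by_cases h : i = i₀
          · rw [h, h0, smul_zero]
          · rw [Pi.single_eq_of_ne h, zero_smul]) i₀ (Finset.mem_insert_self _ _)
      rw [Pi.single_eq_same] at this
      exact one_ne_zero this
    have hpow : ∀ z : L, z ^ Nat.card K = z ^ (Nat.card K - 1) * z := fun z => by
      rw [← pow_succ, Nat.sub_add_cancel hq.le]
    -- Elimination of the column `i₀`: subtracting `c ^ q ^ e` times check `e` from check `e + 1`
    -- gives check `e` for the columns `η'`, and `η' i₀ = 0` by the choice of `c`.
    set c : L := a (lab i₀) * η i₀ ^ (Nat.card K - 1) with hc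
    set η' : ι → L := fun i => a (lab i) * η i ^ Nat.card K - c * η i with hη'
    have hs : ∀ i ∈ s, y i = 0 := by
      refine ih η' (n - 1) (by omega) ?_ ?_
      -- Independence survives: a relation among the `η'` with label `l` gives `z` with `a l * z ^ q
      -- = c * z`. If `z ≠ 0`, then `a l` and `a (lab i₀)` are conjugate, so `l = lab i₀` and `z` is
      -- a `K`-multiple of `η i₀`. In either case the relation extends to one among the `η`.
      · intro l g hg hsum
        set z := ∑ i ∈ s, g i • η i with hz
        have hzeq : a l * z ^ Nat.card K = c * z := by
          obtain ⟨f, hf⟩ := exists_algHom_apply_eq_pow (L := L) K 1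
          simp only [pow_one] at hf
          rw [← sub_eq_zero, ← hsum, hz, ← hf, map_sum, Finset.mul_sum, Finset.mul_sum,
            ← Finset.sum_sub_distrib]
          refine Finset.sum_congr rfl fun i _ => ?_
          by_cases hl : lab i = l
          · rw [map_smul, hf, ← hl, hη', mul_smul_comm, mul_smul_comm, smul_sub]
          · rw [hg i hl]; simp
        have hres : ∀ k : K, (k ≠ 0 → lab i₀ = l) → k • η i₀ + z = 0 → ∀ i ∈ s, g i = 0 := by
          intro k hk hkz i hi
          have := hη l (Function.update g i₀ k) (fun j hj => by
            by_cases hji : j = i₀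
            · subst hji
              rw [Function.update_self]
              exact not_not.1 fun h => hj (hk h)
            · rw [Function.update_of_ne hji, hg j hj]) (by
            rw [Finset.sum_insert hi₀, Function.update_self, ← hkz, hz]
            congr 1
            refine Finset.sum_congr rfl fun j hj => ?_
            rw [Function.update_of_ne]
            rintro rfl
            exact hi₀ hj) i (Finset.mem_insert_of_mem hi)
          rwa [Function.update_of_ne] at this
          rintro rfl
          exact hi₀ hi
        by_cases hz0 : z = 0
        · exact hres 0 (fun h => absurd rfl h) (by rw [hz0]; simp)
        · rw [hpow, ← mul_assoc] at hzeq
          have hzeq' := mul_right_cancel₀ hz0 hzeq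
          have hl : l = lab i₀ := hconj _ _ z (η i₀) hz0 hη₀ hzeq'
          rw [hc, hl] at hzeq'
          have hpw := mul_left_cancel₀ (ha _) hzeq'
          obtain ⟨k, hk⟩ := mem_range_algebraMap_of_pow_card_eq_self (K := K) (x := z / η i₀) (by
            rw [hpow, div_pow, hpw, div_self (pow_ne_zero _ hη₀), one_mul])
          refine hres (-k) (fun _ => hl.symm) ?_
          rw [neg_smul, Algebra.smul_def, hk, div_mul_cancel₀ _ hη₀, neg_add_cancel]
      · intro e he
        have h1 := hy (e + 1) (by omega)
        have h2 := hy e (by omega)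
        have h4 : ∑ i ∈ insert i₀ s, y i * skewOp (Nat.card K) (a (lab i)) e (η' i) =
            ∑ i ∈ insert i₀ s, y i * skewOp (Nat.card K) (a (lab i)) (e + 1) (η i) -
              c ^ Nat.card K ^ e *
                ∑ i ∈ insert i₀ s, y i * skewOp (Nat.card K) (a (lab i)) e (η i) := by
          rw [Finset.mul_sum, ← Finset.sum_sub_distrib]
          refine Finset.sum_congr rfl fun i _ => ?_
          obtain ⟨f, hf⟩ := exists_linearMap_apply_eq_skewOp K (a (lab i)) e
          rw [skewOp_succ, hη', ← hf, map_sub, hf, hf, skewOp_mul _ _ _ c]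
          ring
        rw [h1, h2, mul_zero, sub_zero, Finset.sum_insert hi₀] at h4
        have h5 : η' i₀ = 0 := by
          simp only [hη', hc, hpow, mul_assoc, sub_self]
        obtain ⟨f, hf⟩ := exists_linearMap_apply_eq_skewOp K (a (lab i₀)) e
        rwa [h5, ← hf, map_zero, mul_zero, zero_add] at h4
    have h0 := hy 0 (by omega)
    rw [Finset.sum_insert hi₀, Finset.sum_eq_zero fun i hi => by rw [hs i hi, zero_mul], add_zero,
      skewOp_zero] at h0
    intro i hi
    rcases Finset.mem_insert.1 hi with rfl | hi
    · exact (mul_eq_zero.1 h0).resolve_right hη₀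
    · exact hs i hi

/-- Raising to the power `M = (q ^ h - 1) / (q - 1)`, the norm to the subfield of order `q`, kills
the factors `x ^ (q - 1)` and `y ^ (q - 1)`. The exponents `l * M` and `l' * M` stay below the order
of `γ`. -/
theorem eq_of_pow_mul_pow_eq_pow_mul_pow [Finite L] {q h : ℕ} (hL : Nat.card L = q ^ h)
    (hq : 1 < q) (hh : h ≠ 0) {γ : L} (hγ : IsPrimitiveRoot γ (q ^ h - 1)) {l l' : ℕ}
    (hl : l < q - 1) (hl' : l' < q - 1) {x y : L} (hx : x ≠ 0) (hy : y ≠ 0)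
    (heq : γ ^ l * x ^ (q - 1) = γ ^ l' * y ^ (q - 1)) : l = l' := by
  have := Fintype.ofFinite L
  obtain ⟨M, hM⟩ : q - 1 ∣ q ^ h - 1 := by simpa using Nat.sub_dvd_pow_sub_pow q 1 h
  have hpow : ∀ z : L, z ≠ 0 → (z ^ (q - 1)) ^ M = 1 := fun z hz => by
    rw [← pow_mul, ← hM, ← hL, Nat.card_eq_fintype_card, FiniteField.pow_card_sub_one_eq_one z hz]
  have h1 := congrArg (· ^ M) heq
  simp only [mul_pow, hpow x hx, hpow y hy, mul_one, ← pow_mul] at h1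
  have hpos : 0 < q ^ h - 1 := by
    have := Nat.one_lt_pow hh hq
    omega
  have hM0 : 0 < M := by
    rcases Nat.eq_zero_or_pos M with h0 | h0
    · rw [h0] at hM; omega
    · exact h0
  have h2 := hγ.pow_inj (by rw [hM]; exact Nat.mul_lt_mul_of_pos_right hl hM0)
    (by rw [hM]; exact Nat.mul_lt_mul_of_pos_right hl' hM0) h1
  exact Nat.eq_of_mul_eq_mul_right hM0 h2

end SkewOperators

/-! ### Codes with a block parity check matrix. -/

section BlockCodes

variable {F : Type*} [Field F] {β n : Type*} [Fintype β] [DecidableEq β] [Fintype n]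

theorem mem_codeOf_blockMatrix {a b : Type*} {A : β → Matrix a n F} {B : β → Matrix b n F}
    {x : β × n → F} :
    x ∈ codeOf (blockMatrix A B) ↔
      (∀ l p, ∑ j, A l p j * x (l, j) = 0) ∧ ∀ p, ∑ l, ∑ j, B l p j * x (l, j) = 0 := by
  have hinl : ∀ l p, (blockMatrix A B).mulVec x (Sum.inl (l, p)) = ∑ j, A l p j * x (l, j) := by
    intro l p
    simp only [blockMatrix, Matrix.mulVec, dotProduct, Fintype.sum_prod_type, Matrix.of_apply,
      Sum.elim_inl]
    rw [Finset.sum_eq_single l]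
    · simp
    · intro l' _ hl'
      exact Finset.sum_eq_zero fun j _ => by rw [if_neg hl'.symm, zero_mul]
    · simp
  have hinr : ∀ p, (blockMatrix A B).mulVec x (Sum.inr p) = ∑ l, ∑ j, B l p j * x (l, j) := by
    intro p
    simp only [blockMatrix, Matrix.mulVec, dotProduct, Fintype.sum_prod_type, Matrix.of_apply,
      Sum.elim_inr]
  unfold codeOf
  rw [LinearMap.mem_ker, Matrix.mulVecLin_apply, funext_iff, Sum.forall]
  simp only [Prod.forall, hinl, hinr, Pi.zero_apply]

omit [DecidableEq β] in
theorem card_le_finrank_codeOf_add_card {ρ ν : Type*} [Fintype ρ] [Fintype ν]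
    (H : Matrix ρ ν F) :
    Fintype.card ν ≤ Module.finrank F (codeOf H) + Fintype.card ρ := by
  have h1 := LinearMap.finrank_range_add_finrank_ker H.mulVecLin
  have h2 := Submodule.finrank_le (LinearMap.range H.mulVecLin)
  rw [Module.finrank_fintype_fun_eq_card] at h1 h2
  unfold codeOf
  omega

end BlockCodes

/-! ### Erasure correction in the base code. -/

section BaseCode

open Polynomial

variable {K L : Type*} [Field K] [Field L] [Algebra K L] {β : Type*} [Fintype β] [DecidableEq β]
  {N : ℕ}

/-- The code with parity check matrix `H`, whose blocks have the parameters `a l`. -/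
def baseCode {h : ℕ} (q δ : ℕ) (α : Fin N → K) (b : Fin h → L) (a : β → L) :
    Submodule L (β × Fin N → L) :=
  codeOf (blockMatrix (fun _ => baseP L δ α) (fun l => baseD q h (a l) (baseBeta δ α b)))

variable {h q δ : ℕ} {α : Fin N → K} {a : β → L}

/-- The rows of the local block are the monomials of degree at most `δ - 2`, so every polynomial of
such degree is a check on each block. -/
theorem sum_eval_mul_eq_zero {b : Fin h → L} {x : β × Fin N → L} (hx : x ∈ baseCode q δ α b a)
    (l : β) (p : K[X]) (hp : p.natDegree < δ - 1) :
    ∑ j, algebraMap K L (p.eval (α j)) * x (l, j) = 0 := by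
  have h1 := (mem_codeOf_blockMatrix.1 hx).1 l
  simp only [eval_eq_sum_range' hp, map_sum, map_mul, Finset.sum_mul]
  rw [Finset.sum_comm]
  refine Finset.sum_eq_zero fun i hi => ?_
  have h2 := h1 ⟨i, Finset.mem_range.1 hi⟩
  simp only [baseP, Matrix.of_apply] at h2
  rw [← mul_zero (algebraMap K L (p.coeff i)), ← h2, Finset.mul_sum]
  refine Finset.sum_congr rfl fun j _ => ?_
  rw [map_pow]
  ring

/-- Each local code has distance at least `δ`. -/
theorem baseCode_block_eq_zero {b : Fin h → L} {x : β × Fin N → L}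
    (hx : x ∈ baseCode q δ α b a) (hα : Function.Injective α) (l : β) (T : Finset (Fin N))
    (hT : T.card < δ) (hxT : ∀ j ∉ T, x (l, j) = 0) (j : Fin N) : x (l, j) = 0 := by
  by_cases hj : j ∈ T
  swap
  · exact hxT j hj
  -- The polynomial vanishing at the other points of `T` has degree at most `δ - 2`, and its check
  -- isolates `x (l, j)`.
  have h1 := sum_eval_mul_eq_zero hx l (Lagrange.nodal (T.erase j) α) (by
    have := Finset.card_pos.2 ⟨j, hj⟩
    rw [Lagrange.natDegree_nodal, Finset.card_erase_of_mem hj]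
    omega)
  rw [Finset.sum_eq_single j] at h1
  · refine (mul_eq_zero.1 h1).resolve_left ?_
    refine (_root_.map_ne_zero (algebraMap K L)).2 ?_
    refine Lagrange.eval_nodal_not_at_node fun i hi => hα.ne ?_
    exact (Finset.ne_of_mem_erase hi).symm
  · intro i _ hij
    by_cases hi : i ∈ T
    · rw [Lagrange.eval_nodal_at_node (Finset.mem_erase.2 ⟨hij, hi⟩), map_zero, zero_mul]
    · rw [hxT i hi, mul_zero]
  · simp

/-- `f j` minus the value at `j` of the polynomial that interpolates `f` on `E`. -/
noncomputable def interpolationError {M : Type*} [AddCommGroup M] [Module K M] (α : Fin N → K)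
    (E : Finset (Fin N)) (f : Fin N → M) (j : Fin N) : M :=
  f j - ∑ i ∈ E, (Lagrange.basis E α i).eval (α j) • f i

theorem interpolationError_of_mem {M : Type*} [AddCommGroup M] [Module K M]
    (hα : Function.Injective α) {E : Finset (Fin N)} (f : Fin N → M) {j : Fin N} (hj : j ∈ E) :
    interpolationError α E f j = 0 := by
  unfold interpolationError
  rw [Finset.sum_eq_single_of_mem j hj, Lagrange.eval_basis_self hα.injOn hj, one_smul, sub_self]
  intro i _ hij
  rw [Lagrange.eval_basis_of_ne hij hj, zero_smul]

theorem interpolationError_eval_of_degree_lt (hα : Function.Injective α) {E : Finset (Fin N)}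
    {p : K[X]} (hp : p.degree < E.card) (j : Fin N) :
    interpolationError α E (fun i => p.eval (α i)) j = 0 := by
  have h := congrArg (eval (α j)) (Lagrange.eq_interpolate (s := E) hα.injOn hp)
  rw [Lagrange.interpolate_apply, eval_finsetSum] at h
  unfold interpolationError
  beta_reduce
  rw [h, sub_eq_zero]
  refine Finset.sum_congr rfl fun i _ => ?_
  rw [eval_mul, eval_C, smul_eq_mul, mul_comm]

theorem map_interpolationError {M M' : Type*} [AddCommGroup M] [Module K M] [AddCommGroup M']
    [Module K M'] (φ : M →ₗ[K] M') (E : Finset (Fin N)) (f : Fin N → M) (j : Fin N) :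
    φ (interpolationError α E f j) = interpolationError α E (fun i => φ (f i)) j := by
  simp [interpolationError]

theorem interpolationError_sum_mul {ι : Type*} (s : Finset ι) (c : ι → K) (E : Finset (Fin N))
    (f : ι → Fin N → K) (j : Fin N) :
    interpolationError α E (fun i => ∑ e ∈ s, c e * f e i) j =
      ∑ e ∈ s, c e * interpolationError α E (f e) j := by
  simp only [interpolationError, smul_eq_mul, mul_sub, Finset.mul_sum, Finset.sum_sub_distrib]
  congr 1
  rw [Finset.sum_comm]
  refine Finset.sum_congr rfl fun e _ => Finset.sum_congr rfl fun i _ => ?_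
  ring

/-- The interpolant has degree at most `δ - 2`, hence pairs to zero with a block of a codeword. This
is what removes the positions in `E` from the global checks. -/
theorem sum_mul_interpolationError {b : Fin h → L} {x : β × Fin N → L}
    (hx : x ∈ baseCode q δ α b a) (hα : Function.Injective α) (hδ : 2 ≤ δ) (l : β)
    {E : Finset (Fin N)} (hE : E.card = δ - 1) (f : Fin N → L) :
    ∑ j, x (l, j) * interpolationError α E f j = ∑ j, x (l, j) * f j := by
  simp only [interpolationError, mul_sub, Finset.sum_sub_distrib, sub_eq_self, Finset.mul_sum]
  rw [Finset.sum_comm]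
  refine Finset.sum_eq_zero fun i hi => ?_
  have h1 := sum_eval_mul_eq_zero hx l (Lagrange.basis E α i) (by
    rw [Lagrange.natDegree_basis hα.injOn hi]
    omega)
  rw [← mul_zero (f i), ← h1, Finset.mul_sum]
  refine Finset.sum_congr rfl fun j _ => ?_
  rw [Algebra.smul_def]
  ring

theorem interpolationError_baseBeta (b : Fin h → L) (E : Finset (Fin N)) (j : Fin N) :
    interpolationError α E (baseBeta δ α b) j =
      ∑ e : Fin h, interpolationError α E (fun i => α i ^ (δ - 1 + (e : ℕ))) j • b e := by
  simp only [interpolationError, baseBeta, sub_smul, Finset.sum_sub_distrib, Finset.sum_smul,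
    Finset.smul_sum, smul_eq_mul]
  congr 1
  · exact Finset.sum_congr rfl fun e _ => by rw [Algebra.smul_def, map_pow, mul_comm]
  · rw [Finset.sum_comm]
    refine Finset.sum_congr rfl fun e _ => Finset.sum_congr rfl fun i _ => ?_
    rw [Algebra.smul_def, Algebra.smul_def, map_mul, map_pow]
    ring

/-- The interpolation errors of the `β_j` are linearly independent over `K`. -/
theorem eq_zero_of_sum_smul_interpolationError_eq_zero (b : Module.Basis (Fin h) K L)
    (hα : Function.Injective α) {E : Finset (Fin N)} (hE : E.card = δ - 1) {J : Finset (Fin N)}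
    (hJ : J.card ≤ h) (hJE : Disjoint J E) (g : Fin N → K)
    (hg : ∑ j ∈ J, g j • interpolationError α E (baseBeta δ α b) j = 0) :
    ∀ j ∈ J, g j = 0 := by
  have hmon : ∀ e < δ - 1 + h,
      ∑ j ∈ J, g j * interpolationError α E (fun i => α i ^ e) j = 0 := by
    intro e he
    by_cases hlt : e < δ - 1
    · refine Finset.sum_eq_zero fun j _ => ?_
      have := interpolationError_eval_of_degree_lt hα (E := E) (p := X ^ e) (by
        rw [degree_X_pow, hE]
        exact_mod_cast hlt) j
      simp only [eval_pow, eval_X] at this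
      rw [this, mul_zero]
    · have h1 := hg
      simp only [interpolationError_baseBeta, Finset.smul_sum, smul_smul] at h1
      rw [Finset.sum_comm] at h1
      simp only [← Finset.sum_smul] at h1
      have h2 := Fintype.linearIndependent_iff.1 b.linearIndependent _ h1
        ⟨e - (δ - 1), by omega⟩
      simpa only [Nat.add_sub_cancel' (not_lt.1 hlt)] using h2
  intro j hj
  have hpoly : ∀ p : K[X], p.natDegree < δ - 1 + h →
      ∑ j ∈ J, g j * interpolationError α E (fun i => p.eval (α i)) j = 0 := by
    intro p hp
    simp only [eval_eq_sum_range' hp, interpolationError_sum_mul, Finset.mul_sum]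
    rw [Finset.sum_comm]
    refine Finset.sum_eq_zero fun e he => ?_
    rw [← mul_zero (p.coeff e), ← hmon e (Finset.mem_range.1 he), Finset.mul_sum]
    exact Finset.sum_congr rfl fun _ _ => by ring
  have hjE : j ∉ E := Finset.disjoint_left.1 hJE hj
  -- This polynomial has degree at most `δ - 1 + h - 1`. It vanishes on `E`, so it equals its own
  -- interpolation error, and on `J` it is nonzero only at `j`.
  have h3 := hpoly (Lagrange.nodal (E ∪ J.erase j) α) (by
    have h4 := Finset.card_union_le E (J.erase j)
    have h5 := Finset.card_pos.2 ⟨j, hj⟩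
    rw [Finset.card_erase_of_mem hj] at h4
    rw [Lagrange.natDegree_nodal]
    omega)
  have herr : ∀ k, interpolationError α E
      (fun i => (Lagrange.nodal (E ∪ J.erase j) α).eval (α i)) k =
        (Lagrange.nodal (E ∪ J.erase j) α).eval (α k) := by
    intro k
    unfold interpolationError
    rw [Finset.sum_eq_zero, sub_zero]
    intro i hi
    beta_reduce
    rw [Lagrange.eval_nodal_at_node (Finset.mem_union_left _ hi), smul_zero]
  simp only [herr] at h3
  rw [Finset.sum_eq_single_of_mem j hj] at h3
  · refine (mul_eq_zero.1 h3).resolve_right ?_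
    refine Lagrange.eval_nodal_not_at_node fun i hi => hα.ne ?_
    rintro rfl
    rcases Finset.mem_union.1 hi with hi | hi
    · exact hjE hi
    · exact Finset.notMem_erase _ _ hi
  · intro i hi hij
    rw [Lagrange.eval_nodal_at_node (Finset.mem_union_right _ (Finset.mem_erase.2 ⟨hij, hi⟩)),
      mul_zero]

/-- A codeword of the base code that is supported on `δ - 1` symbols of every block and `h`
further symbols is zero. -/
theorem baseCode_eq_zero [Finite K] (b : Module.Basis (Fin h) K L)
    (hα : Function.Injective α) (hδ : 2 ≤ δ) (ha : ∀ l, a l ≠ 0)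
    (hconj : ∀ l l' : β, ∀ x y : L, x ≠ 0 → y ≠ 0 →
      a l * x ^ (Nat.card K - 1) = a l' * y ^ (Nat.card K - 1) → l = l')
    {x : β × Fin N → L} (hx : x ∈ baseCode (Nat.card K) δ α b a)
    (E : β → Finset (Fin N)) (hE : ∀ l, (E l).card = δ - 1) (J : Finset (β × Fin N))
    (hJ : J.card ≤ h) (hxJ : ∀ p ∉ J, p.2 ∉ E p.1 → x p = 0) : x = 0 := by
  set J' := J.filter fun p => p.2 ∉ E p.1 with hJ'
  have hJ'card : J'.card ≤ h := (Finset.card_filter_le _ _).trans hJ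
  set η : β × Fin N → L := fun p => interpolationError α (E p.1) (baseBeta δ α b) p.2 with hη
  have hzero : ∀ p ∈ J', x p = 0 := by
    refine eq_zero_of_sum_mul_skewOp_eq_zero Prod.fst a ha hconj J' η x h hJ'card ?_ ?_
    · intro l g hg hsum p hp
      by_cases hpl : p.1 = l
      swap
      · exact hg p hpl
      subst hpl
      refine eq_zero_of_sum_smul_interpolationError_eq_zero b hα (hE p.1)
        (J := (J'.filter fun p' => p'.1 = p.1).image Prod.snd)
        ((Finset.card_image_le.trans (Finset.card_filter_le _ _)).trans hJ'card) ?_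
        (fun j => g (p.1, j)) ?_ p.2
        (Finset.mem_image.2 ⟨p, Finset.mem_filter.2 ⟨hp, rfl⟩, rfl⟩)
      · rw [Finset.disjoint_left]
        intro j hj
        obtain ⟨p', hp', rfl⟩ := Finset.mem_image.1 hj
        rw [Finset.mem_filter] at hp'
        rw [← hp'.2]
        exact (Finset.mem_filter.1 hp'.1).2
      · rw [Finset.sum_image]
        · rw [← hsum, Finset.sum_filter]
          refine Finset.sum_congr rfl fun p' _ => ?_
          split_ifs with hpp
          · rw [← hpp]
          · rw [hg p' hpp, zero_smul]
        · intro p₁ h₁ p₂ h₂ h12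
          exact Prod.ext ((Finset.mem_filter.1 h₁).2.trans (Finset.mem_filter.1 h₂).2.symm) h12
    · intro e he
      have h1 := (mem_codeOf_blockMatrix.1 hx).2 ⟨e, he⟩
      simp only [baseD, Matrix.of_apply] at h1
      -- The operator is `K`-linear and so commutes with interpolation; thus `β` may be replaced by
      -- its error `η`. Afterwards only `J'` contributes: on `E` the error is zero, elsewhere `x`
      -- is.
      have h2 : ∀ l, ∑ j, skewOp (Nat.card K) (a l) e (baseBeta δ α b j) * x (l, j) =
          ∑ j, x (l, j) * skewOp (Nat.card K) (a l) e (η (l, j)) := by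
        intro l
        obtain ⟨f, hf⟩ := exists_linearMap_apply_eq_skewOp K (a l) e
        simp only [← hf, hη, map_interpolationError]
        rw [sum_mul_interpolationError hx hα hδ l (hE l)]
        exact Finset.sum_congr rfl fun _ _ => mul_comm _ _
      simp only [h2] at h1
      rw [← h1, ← Fintype.sum_prod_type' (f := fun l j =>
        x (l, j) * skewOp (Nat.card K) (a l) e (η (l, j)))]
      refine Finset.sum_subset (Finset.subset_univ _) fun p _ hp => ?_
      obtain ⟨f, hf⟩ := exists_linearMap_apply_eq_skewOp K (a p.1) e
      by_cases hpE : p.2 ∈ E p.1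
      · rw [← hf, hη]
        simp only [interpolationError_of_mem hα _ hpE, map_zero, mul_zero]
      · rw [hxJ p (fun h => hp (Finset.mem_filter.2 ⟨h, hpE⟩)) hpE, zero_mul]
  funext p
  -- What is left is supported on `δ - 1` positions in each block, which the local checks correct.
  refine baseCode_block_eq_zero hx hα p.1 (E p.1) (by rw [hE]; omega) (fun j hj => ?_) p.2
  by_cases hjJ : (p.1, j) ∈ J
  · exact hzero _ (Finset.mem_filter.2 ⟨hjJ, hj⟩)
  · exact hxJ _ hjJ hj

theorem card_mul_le_finrank_baseCode_add (b : Fin h → L) :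
    Fintype.card β * N ≤
      Module.finrank L (baseCode q δ α b a) + (Fintype.card β * (δ - 1) + h) := by
  have := card_le_finrank_codeOf_add_card (blockMatrix (fun _ : β => baseP L δ α)
    (fun l => baseD q h (a l) (baseBeta δ α b)))
  rw [Fintype.card_prod, Fintype.card_fin, Fintype.card_sum, Fintype.card_prod, Fintype.card_fin,
    Fintype.card_fin] at this
  exact this

end BaseCode

/-! ### Consequences of genericity: dimension, locality, maximal recoverability, distance. -/

section BlockGeneric

open Module

variable {F : Type*} [Field F]

/-- The repair sets are the fibers of `f`. By `hpos` and `hrep` they are nonempty, so there are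
exactly as many parts as elements of `β`. -/
theorem isMRCode_of_fibers {ι β : Type*} [Fintype ι] [Fintype β] (f : ι → β)
    {C : Submodule F (ι → F)} {r h δ : ℕ} (hpos : 0 < r + δ - 1)
    (hrep : ∀ l, ∀ S : Finset ι, (∀ i, i ∈ S ↔ f i = l) →
      IsRepairSet C r δ S ∧ S.card = r + δ - 1)
    (hmds : ∀ S : Finset ι,
      (∀ l, ∀ T : Finset ι, (∀ i, i ∈ T ↔ f i = l ∧ i ∉ S) → T.card = δ - 1) →
        IsMDS (puncture C S))
    (hrank : finrank F C + h = Fintype.card β * r) : IsMRCode C r h δ := by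
  classical
  set B : β → Finset ι := fun l => Finset.univ.filter fun i => f i = l with hB
  have hmem : ∀ l i, i ∈ B l ↔ f i = l := fun l i => by simp [hB]
  have hne : ∀ l, (B l).Nonempty := fun l => by
    rw [← Finset.card_pos, (hrep l (B l) (hmem l)).2]
    exact hpos
  have hinj : Function.Injective B := by
    intro l l' hll
    obtain ⟨i, hi⟩ := hne l
    have hi' := hi
    rw [hll] at hi'
    exact ((hmem _ _).1 hi).symm.trans ((hmem _ _).1 hi')
  let P : Finpartition (Finset.univ : Finset ι) := Finpartition.ofExistsUnique
    (Finset.univ.image B) (fun _ _ => Finset.subset_univ _) (fun i _ => by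
      refine ⟨B (f i), ⟨Finset.mem_image_of_mem _ (Finset.mem_univ _), (hmem _ _).2 rfl⟩, ?_⟩
      rintro t ⟨ht, hit⟩
      obtain ⟨l, -, rfl⟩ := Finset.mem_image.1 ht
      rw [(hmem _ _).1 hit]) (fun h => by
      obtain ⟨l, -, hl⟩ := Finset.mem_image.1 h
      exact (hne l).ne_empty hl)
  have hparts : ∀ s, s ∈ P.parts ↔ ∃ l, B l = s := fun s => by
    change s ∈ Finset.univ.image B ↔ _
    simp
  refine ⟨P, ?_, ?_, ?_, ?_⟩
  · intro s hs
    obtain ⟨l, rfl⟩ := (hparts s).1 hs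
    exact (hrep l _ (hmem l)).1
  · intro R hR
    refine hmds _ fun l T hT => ?_
    rw [← (hR (B l) ((hparts _).2 ⟨l, rfl⟩)).2]
    congr 1
    ext i
    rw [hT, Finset.mem_sdiff, hmem]
    refine and_congr_right fun hil => not_congr ?_
    rw [Finset.mem_biUnion]
    constructor
    · rintro ⟨s, hs, his⟩
      obtain ⟨l', rfl⟩ := (hparts s).1 hs
      have := (hmem _ _).1 ((hR _ hs).1 his)
      rwa [← hil, this]
    · exact fun hi => ⟨B l, (hparts _).2 ⟨l, rfl⟩, hi⟩
  · intro s hs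
    obtain ⟨l, rfl⟩ := (hparts s).1 hs
    exact (hrep l _ (hmem l)).2
  · rw [hrank]
    congr 1
    change _ = (Finset.univ.image B).card
    rw [Finset.card_image_of_injective _ hinj, Finset.card_univ]

/-- Codes of block length `N` that behave generically: the blocks have distance at least `δ`, and
`δ - 1` symbols of every block together with `h` further symbols can be corrected. -/
structure IsBlockGeneric {β : Type*} [Fintype β] {N : ℕ} (C : Submodule F (β × Fin N → F))
    (δ h : ℕ) : Prop where
  block_eq_zero : ∀ x ∈ C, ∀ (l : β) (T : Finset (Fin N)), T.card < δ →
    (∀ j ∉ T, x (l, j) = 0) → ∀ j, x (l, j) = 0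
  eq_zero : ∀ x ∈ C, ∀ E : β → Finset (Fin N), (∀ l, (E l).card = δ - 1) →
    ∀ J : Finset (β × Fin N), J.card ≤ h → (∀ p ∉ J, p.2 ∉ E p.1 → x p = 0) → x = 0
  card_mul_le : Fintype.card β * N ≤ finrank F C + (Fintype.card β * (δ - 1) + h)

namespace IsBlockGeneric

variable {β : Type*} [Fintype β] {r δ h : ℕ} {C : Submodule F (β × Fin (r + δ - 1) → F)}

theorem eq_zero_of_card_sdiff_le [DecidableEq β] (hC : IsBlockGeneric C δ h)
    {E : Finset (Fin (r + δ - 1))} (hE : E.card = δ - 1) (S : Finset (β × Fin (r + δ - 1)))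
    (hS : ((Finset.univ : Finset β) ×ˢ Eᶜ \ S).card ≤ h) {x : β × Fin (r + δ - 1) → F}
    (hx : x ∈ C) (hxS : ∀ p ∈ S, x p = 0) : x = 0 := by
  refine hC.eq_zero x hx (fun _ => E) (fun _ => hE) _ hS fun p hp hpE => hxS p ?_
  by_contra hpS
  exact hp (Finset.mem_sdiff.2 ⟨by simpa using hpE, hpS⟩)

/-- Counting checks bounds the dimension from below. From above, a codeword vanishing outside a
correctable pattern of `δ - 1` positions per block and `h` more is zero. -/
theorem finrank_add_eq (hC : IsBlockGeneric C δ h) (hr : 1 ≤ r) (hδ : 1 ≤ δ)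
    (hh : h ≤ Fintype.card β * r) : finrank F C + h = Fintype.card β * r := by
  classical
  have hN : r + δ - 1 = r + (δ - 1) := by omega
  refine le_antisymm ?_ ?_
  · obtain ⟨E, -, hE⟩ := Finset.exists_subset_card_eq
      (show δ - 1 ≤ (Finset.univ : Finset (Fin (r + δ - 1))).card by
        rw [Finset.card_univ, Fintype.card_fin]; omega)
    have hG : ((Finset.univ : Finset β) ×ˢ Eᶜ).card = Fintype.card β * r := by
      rw [Finset.card_product, Finset.card_univ, Finset.card_compl, hE, Fintype.card_fin]
      congr 1
      omega
    obtain ⟨J, hJG, hJ⟩ := Finset.exists_subset_card_eq (hh.trans_eq hG.symm)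
    have h1 := finrank_le_finrank_vanishingOn_add_card C ((Finset.univ : Finset β) ×ˢ Eᶜ \ J)
    have h2 : vanishingOn C ((Finset.univ : Finset β) ×ˢ Eᶜ \ J) = ⊥ := by
      rw [eq_bot_iff]
      rintro x ⟨hx, hx0⟩
      refine hC.eq_zero_of_card_sdiff_le hE _ ?_ hx hx0
      rw [Finset.sdiff_sdiff_eq_self hJG, hJ]
    rw [h2, finrank_bot, Finset.card_sdiff_of_subset hJG, hG, hJ] at h1
    omega
  · have h1 := hC.card_mul_le
    have h2 := congrArg (Fintype.card β * ·) hN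
    simp only [mul_add] at h2
    omega

theorem isRepairSet_of_mem_iff (hC : IsBlockGeneric C δ h) (l : β)
    (S : Finset (β × Fin (r + δ - 1))) (hS : ∀ p, p ∈ S ↔ p.1 = l) :
    IsRepairSet C r δ S ∧ S.card = r + δ - 1 := by
  classical
  have hcard : S.card = r + δ - 1 := by
    have : S = {l} ×ˢ Finset.univ := by
      ext p
      rw [hS, Finset.mem_product, Finset.mem_singleton]
      simp
    rw [this]
    simp
  refine ⟨⟨hcard.le, natCast_le_minDist_puncture_iff.2 fun c hc T hTS hT hcT p hp => ?_⟩, hcard⟩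
  have := hC.block_eq_zero c hc l (T.image Prod.snd) (Finset.card_image_le.trans_lt hT)
    (fun j hj => hcT (l, j) ((hS _).2 rfl) fun h => hj (Finset.mem_image_of_mem Prod.snd h)) p.2
  rwa [← (hS p).1 hp] at this

theorem hasLocality (hC : IsBlockGeneric C δ h) : HasLocality C r δ := by
  classical
  intro i
  exact ⟨Finset.univ.filter fun p => p.1 = i.1, by simp,
    (hC.isRepairSet_of_mem_iff i.1 _ (by simp)).1⟩

theorem isMRCode (hC : IsBlockGeneric C δ h) (hr : 1 ≤ r) (hδ : 1 ≤ δ)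
    (hh : h < Fintype.card β * r) : IsMRCode C r h δ := by
  classical
  have hrank := hC.finrank_add_eq hr hδ hh.le
  refine isMRCode_of_fibers Prod.fst (by omega) hC.isRepairSet_of_mem_iff (fun S hS => ?_) hrank
  set E : β → Finset (Fin (r + δ - 1)) := fun l => Finset.univ.filter fun j => (l, j) ∉ S with hE
  have hEcard : ∀ l, (E l).card = δ - 1 := fun l => by
    rw [← hS l ((E l).map ⟨Prod.mk l, Prod.mk_right_injective l⟩), Finset.card_map]
    rintro ⟨l', j⟩
    simp only [hE, Finset.mem_map, Finset.mem_filter, Finset.mem_univ, true_and,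
      Function.Embedding.coeFn_mk, Prod.mk.injEq]
    constructor
    · rintro ⟨j', hj', rfl, rfl⟩
      exact ⟨rfl, hj'⟩
    · rintro ⟨rfl, hj⟩
      exact ⟨j, hj, rfl, rfl⟩
  have hcorrect : ∀ c ∈ C, ∀ J : Finset (β × Fin (r + δ - 1)), J.card ≤ h →
      (∀ p ∈ S, p ∉ J → c p = 0) → c = 0 := fun c hc J hJ hcJ =>
    hC.eq_zero c hc E hEcard J hJ fun p hp hpE => hcJ p (by simpa [hE] using hpE) hp
  have hScard : S.card = Fintype.card β * r := by
    have h1 : Sᶜ.card = Fintype.card β * (δ - 1) := by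
      rw [Finset.card_eq_sum_card_fiberwise (f := Prod.fst) (t := Finset.univ)
        (fun _ _ => Finset.mem_univ _), Finset.sum_congr rfl fun l _ => hS l _ fun p => by
          rw [Finset.mem_filter, Finset.mem_compl, and_comm]]
      simp
    have h2 := Finset.card_compl S
    have h3 := Finset.card_le_univ S
    have h4 := congrArg (Fintype.card β * ·) (show r + δ - 1 = r + (δ - 1) by omega)
    simp only [mul_add] at h4
    rw [Fintype.card_prod, Fintype.card_fin] at h2 h3
    omega
  have hfin : finrank F (puncture C S) = finrank F C :=
    finrank_puncture_of_forall_eq_zero fun c hc hcS =>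
      hcorrect c hc ∅ (Nat.zero_le _) fun p hp _ => hcS p hp
  -- The strict inequality `hh` makes the dimension positive; the zero code has distance `⊤` and is
  -- not MDS.
  refine isMDS_of_le_minDist (e := h) ?_ (by omega) ?_
  · refine natCast_le_minDist_puncture_iff.2 fun c hc T _ hT hcT p _ => ?_
    rw [hcorrect c hc T (by omega) hcT]
    rfl
  · rw [hfin, hrank, Fintype.card_coe, hScard]

theorem le_minDist (hC : IsBlockGeneric C δ h) (hδ : 1 ≤ δ) {s : ℕ} (hs : h = s * r) :
    ((s * (r + δ - 1) + δ : ℕ) : ℕ∞) ≤ minDist C := by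
  classical
  refine natCast_le_minDist_iff.2 fun x hx T hT hxT => ?_
  have hN : r + δ - 1 = r + (δ - 1) := by omega
  set W : β → Finset (Fin (r + δ - 1)) := fun l => (T.filter fun p => p.1 = l).image Prod.snd
    with hW
  have hmemW : ∀ l j, j ∈ W l ↔ (l, j) ∈ T := by
    intro l j
    simp only [hW, Finset.mem_image, Finset.mem_filter]
    constructor
    · rintro ⟨p, ⟨hp, rfl⟩, rfl⟩
      exact hp
    · exact fun hp => ⟨_, ⟨hp, rfl⟩, rfl⟩
  -- Blocks outside `A` vanish by local correction. In a block of `A`, `δ - 1` support positions go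
  -- into `E` and the others count towards the `h` extra erasures.
  set A : Finset β := Finset.univ.filter fun l => δ ≤ (W l).card with hA
  have hE : ∀ l, ∃ E : Finset (Fin (r + δ - 1)), E.card = δ - 1 ∧ (l ∈ A → E ⊆ W l) := by
    intro l
    by_cases hl : l ∈ A
    · obtain ⟨E, h1, h2⟩ := Finset.exists_subset_card_eq (s := W l) (n := δ - 1) (by
        have := (Finset.mem_filter.1 hl).2
        omega)
      exact ⟨E, h2, fun _ => h1⟩
    · obtain ⟨E, -, h2⟩ := Finset.exists_subset_card_eq
        (show δ - 1 ≤ (Finset.univ : Finset (Fin (r + δ - 1))).card by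
          rw [Finset.card_univ, Fintype.card_fin]; omega)
      exact ⟨E, h2, fun h => absurd h hl⟩
  choose E hEcard hEW using hE
  have hsum : ∑ l ∈ A, (W l \ E l).card + A.card * (δ - 1) = ∑ l ∈ A, (W l).card := by
    rw [← smul_eq_mul, ← Finset.sum_const, ← Finset.sum_add_distrib]
    refine Finset.sum_congr rfl fun l hl => ?_
    rw [← hEcard l, Finset.card_sdiff_add_card_eq_card (hEW l hl)]
  have hWT : ∑ l ∈ A, (W l).card ≤ T.card := by
    rw [Finset.card_eq_sum_card_fiberwise (f := Prod.fst) (t := Finset.univ)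
      (fun _ _ => Finset.mem_univ _)]
    exact (Finset.sum_le_sum_of_subset (Finset.subset_univ A)).trans
      (Finset.sum_le_sum fun l _ => Finset.card_image_le)
  -- With at most `s` blocks in `A`, each leaves at most `r` positions. With more, at least `(s + 1)
  -- * (δ - 1)` positions of `T` are absorbed by `E`, and the size of `T` leaves at most `s * r`.
  have hle : ∑ l ∈ A, (W l \ E l).card ≤ s * r := by
    rcases le_or_gt A.card s with hAs | hAs
    · refine (Finset.sum_le_card_nsmul A _ r fun l hl => ?_).trans (Nat.mul_le_mul_right r hAs)
      have h1 := Finset.card_le_univ (W l)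
      rw [Finset.card_sdiff_of_subset (hEW l hl), hEcard]
      rw [Fintype.card_fin] at h1
      omega
    · have h1 : (s + 1) * (δ - 1) ≤ A.card * (δ - 1) := Nat.mul_le_mul_right _ hAs
      rw [add_one_mul] at h1
      have h2 := congrArg (s * ·) hN
      simp only [mul_add] at h2
      omega
  refine hC.eq_zero x hx E hEcard (A.biUnion fun l => (W l \ E l).image (Prod.mk l)) ?_ ?_
  · rw [hs]
    exact Finset.card_biUnion_le.trans ((Finset.sum_le_sum fun l _ => Finset.card_image_le).trans
      hle)
  · intro p hp hpE
    by_cases hpA : p.1 ∈ A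
    · refine hxT p fun hpT => hp (Finset.mem_biUnion.2 ⟨p.1, hpA, Finset.mem_image.2 ⟨p.2, ?_, rfl⟩⟩)
      exact Finset.mem_sdiff.2 ⟨(hmemW _ _).2 hpT, hpE⟩
    · refine hC.block_eq_zero x hx p.1 (W p.1) ?_ (fun j hj => hxT _ fun h => hj ((hmemW _ _).2 h))
        p.2
      simpa [hA] using hpA

end IsBlockGeneric

theorem isBlockGeneric_baseCode {K L : Type*} [Field K] [Field L] [Algebra K L] [Finite K]
    {β : Type*} [Fintype β] [DecidableEq β] {N δ h : ℕ} {α : Fin N → K}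
    (b : Module.Basis (Fin h) K L) (hα : Function.Injective α) (hδ : 2 ≤ δ) {a : β → L}
    (ha : ∀ l, a l ≠ 0)
    (hconj : ∀ l l' : β, ∀ x y : L, x ≠ 0 → y ≠ 0 →
      a l * x ^ (Nat.card K - 1) = a l' * y ^ (Nat.card K - 1) → l = l') :
    IsBlockGeneric (baseCode (Nat.card K) δ α b a) δ h where
  block_eq_zero _ hx l T hT hxT j := baseCode_block_eq_zero hx hα l T hT hxT j
  eq_zero _ hx E hE J hJ hxJ := baseCode_eq_zero b hα hδ ha hconj hx E hE J hJ hxJ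
  card_mul_le := card_mul_le_finrank_baseCode_add b

end BlockGeneric

/-! ### Evaluation of the cost bounds. -/

section Bounds

variable {r δ s u t m : ℕ}

theorem readDelta_mergeConstruction (hr : 1 ≤ r) (hδ : 1 ≤ δ) (ht : 1 ≤ t) (hm : m = t * u + s) :
    readDelta t (u * r) (m * (r + δ - 1)) (s * (r + δ - 1) + δ) (singletonDefect r δ) =
      ((u : ℤ) - s) * ((r : ℤ) + δ - 1) - ((δ : ℤ) - 1) := by
  obtain ⟨δ, rfl⟩ := Nat.exists_eq_add_of_le' hδ
  obtain ⟨t, rfl⟩ := Nat.exists_eq_add_of_le' ht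
  subst hm
  unfold readDelta
  rw [← mul_assoc, singletonDefect_mul hr, Nat.add_sub_cancel, ← add_assoc, Nat.add_sub_cancel]
  push_cast
  ring

theorem readBound_mergeConstruction (hr : 1 ≤ r) (hδ : 2 ≤ δ) (ht : 1 ≤ t) (hu : 1 ≤ u)
    (hm : m = t * u + s) :
    readBound t ((u + s) * (r + δ - 1)) (u * r) (m * (r + δ - 1)) (s * (r + δ - 1) + δ) r δ
      (singletonDefect r δ) = t * (((min u s * r : ℕ)) : ℤ) := by
  have hr' : (1 : ℤ) ≤ r := by exact_mod_cast hr
  have hδ' : (2 : ℤ) ≤ δ := by exact_mod_cast hδ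
  have hu' : (1 : ℤ) ≤ u := by exact_mod_cast hu
  have hN : ((r + δ - 1 : ℕ) : ℤ) = (r : ℤ) + δ - 1 := by omega
  unfold readBound
  rw [readDelta_mergeConstruction hr (by omega) ht hm]
  rcases le_or_gt u s with hus | hus
  · have hus' : (u : ℤ) ≤ s := by exact_mod_cast hus
    rw [if_pos (Or.inl (by nlinarith)), min_eq_left hus]
  · have hus' : (s : ℤ) + 1 ≤ u := by exact_mod_cast hus
    -- The quotient is `u - s` minus a fraction in the interval from `0` (excluded, as `2 ≤ δ`) to
    -- `1`.
    have hfloor : ⌊((((u : ℤ) - s) * ((r : ℤ) + δ - 1) - ((δ : ℤ) - 1) : ℤ) : ℚ) /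
        ((r : ℚ) + δ - 1)⌋ = (u : ℤ) - s - 1 := by
      have hr'' : (1 : ℚ) ≤ r := by exact_mod_cast hr
      have hδ'' : (2 : ℚ) ≤ δ := by exact_mod_cast hδ
      have hpos : (0 : ℚ) < (r : ℚ) + δ - 1 := by linarith
      rw [Int.floor_eq_iff, le_div_iff₀ hpos, div_lt_iff₀ hpos]
      push_cast
      constructor <;> nlinarith
    rw [if_neg, hfloor, min_eq_right hus.le]
    · push_cast; ring
    · push Not
      constructor
      · nlinarith
      · push_cast [hN]
        nlinarith

theorem writeBound_mergeConstruction (hr : 1 ≤ r) (hδ : 1 ≤ δ) (ht : 1 ≤ t)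
    (hm : m = t * u + s) :
    writeBound t (u * r) (m * (r + δ - 1)) (s * (r + δ - 1) + δ) (singletonDefect r δ) =
      ((s * (r + δ - 1) : ℕ) : ℤ) := by
  obtain ⟨δ, rfl⟩ := Nat.exists_eq_add_of_le' hδ
  obtain ⟨t, rfl⟩ := Nat.exists_eq_add_of_le' ht
  subst hm
  unfold writeBound
  rw [← mul_assoc, singletonDefect_mul hr, Nat.add_sub_cancel, ← add_assoc r δ 1, Nat.add_sub_cancel]
  push_cast
  ring

theorem distance_mergeConstruction (hr : 1 ≤ r) (hδ : 1 ≤ δ) (hm : m = t * u + s) :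
    ((s * (r + δ - 1) + δ : ℕ) : ℤ) =
      ((m * (r + δ - 1) : ℕ) : ℤ) - ((t * (u * r) : ℕ) : ℤ) + 1 -
        singletonDefect r δ (t * (u * r)) := by
  obtain ⟨δ, rfl⟩ := Nat.exists_eq_add_of_le' hδ
  subst hm
  rw [← mul_assoc, singletonDefect_mul hr, ← add_assoc r δ 1, Nat.add_sub_cancel]
  push_cast
  ring

end Bounds

/-! ### Sizes of the groups and of the common tail. -/

section BlockLabels

variable {g u ℓ s t : ℕ}

theorem mem_group {i : ℕ} {l : Fin g} : l ∈ group g u i ↔ i * u ≤ l ∧ (l : ℕ) < (i + 1) * u := by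
  simp [group]

theorem mem_tail {l : Fin g} : l ∈ tail g ℓ ↔ ℓ ≤ (l : ℕ) := by
  simp [tail]

theorem eq_div_of_mem_group {i : ℕ} {l : Fin g} (h : l ∈ group g u i) : i = (l : ℕ) / u := by
  obtain ⟨h1, h2⟩ := mem_group.1 h
  exact (Nat.div_eq_of_lt_le h1 h2).symm

theorem mem_group_div (hu : 1 ≤ u) (l : Fin g) : l ∈ group g u ((l : ℕ) / u) :=
  mem_group.2 ⟨Nat.div_mul_le_self _ _, by
    rw [mul_comm]
    exact Nat.lt_mul_div_succ _ hu⟩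

theorem notMem_tail_of_mem_group (hℓ : ℓ = t * u) {i : Fin t} {l : Fin g}
    (h : l ∈ group g u i) : l ∉ tail g ℓ := by
  rw [mem_tail, hℓ, not_le]
  exact (mem_group.1 h).2.trans_le (Nat.mul_le_mul_right u i.2)

theorem card_group (hg : g = ℓ + s) (hℓ : ℓ = t * u) (i : Fin t) : (group g u i).card = u := by
  have h : (group g u i).map Fin.valEmbedding = Finset.Ico ((i : ℕ) * u) (((i : ℕ) + 1) * u) := by
    ext k
    have hk : ((i : ℕ) + 1) * u ≤ g := by
      have := Nat.mul_le_mul_right u (show (i : ℕ) + 1 ≤ t from i.2)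
      omega
    simp only [Finset.mem_map, mem_group, Fin.valEmbedding_apply, Finset.mem_Ico]
    constructor
    · rintro ⟨l, hl, rfl⟩
      exact hl
    · exact fun hk' => ⟨⟨k, hk'.2.trans_le hk⟩, hk', rfl⟩
  rw [← Finset.card_map Fin.valEmbedding, h, Nat.card_Ico, add_one_mul, Nat.add_sub_cancel_left]

theorem card_tail (hg : g = ℓ + s) : (tail g ℓ).card = s := by
  have h : (tail g ℓ).map Fin.valEmbedding = Finset.Ico ℓ g := by
    ext k
    simp only [Finset.mem_map, mem_tail, Fin.valEmbedding_apply, Finset.mem_Ico]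
    constructor
    · rintro ⟨l, hl, rfl⟩
      exact ⟨hl, l.2⟩
    · exact fun hk' => ⟨⟨k, hk'.2⟩, hk'.1, rfl⟩
  rw [← Finset.card_map Fin.valEmbedding, h, Nat.card_Ico, hg, Nat.add_sub_cancel_left]

theorem card_group_union_tail (hg : g = ℓ + s) (hℓ : ℓ = t * u) (i : Fin t) :
    (group g u i ∪ tail g ℓ).card = u + s := by
  rw [Finset.card_union_of_disjoint, card_group hg hℓ, card_tail hg]
  exact Finset.disjoint_left.2 fun _ => notMem_tail_of_mem_group hℓ

theorem card_filter_mem_group (hg : g = ℓ + s) (hℓ : ℓ = t * u) (i : Fin t) :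
    ((Finset.univ : Finset {l // l ∈ group g u i ∪ tail g ℓ}).filter
      fun l : {l // l ∈ group g u i ∪ tail g ℓ} => (l : Fin g) ∈ group g u i).card = u := by
  conv_rhs => rw [← card_group hg hℓ i]
  rw [← Finset.card_map (Function.Embedding.subtype _)]
  congr 1
  ext l
  simp only [Finset.mem_map, Finset.mem_filter, Finset.mem_univ, true_and,
    Function.Embedding.subtype_apply]
  exact ⟨by rintro ⟨a, ha, rfl⟩; exact ha, fun h => ⟨⟨l, Finset.mem_union_left _ h⟩, h, rfl⟩⟩

theorem card_filter_mem_tail (hg : g = ℓ + s) (i : ℕ) :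
    ((Finset.univ : Finset {l // l ∈ group g u i ∪ tail g ℓ}).filter
      fun l : {l // l ∈ group g u i ∪ tail g ℓ} => (l : Fin g) ∈ tail g ℓ).card = s := by
  conv_rhs => rw [← card_tail hg]
  rw [← Finset.card_map (Function.Embedding.subtype _)]
  congr 1
  ext l
  simp only [Finset.mem_map, Finset.mem_filter, Finset.mem_univ, true_and,
    Function.Embedding.subtype_apply]
  exact ⟨by rintro ⟨a, ha, rfl⟩; exact ha, fun h => ⟨⟨l, Finset.mem_union_right _ h⟩, h, rfl⟩⟩

end BlockLabels

/-! ### Extension of codewords by zero blocks. -/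

section ExtendBlocks

variable {F : Type*} [Field F] {β n : Type*} [DecidableEq β]

/-- Extension of a word by zero to the blocks outside `S`. -/
def extendBlocks (S : Finset β) : ({l // l ∈ S} × n → F) →ₗ[F] (β × n → F) where
  toFun x p := if h : p.1 ∈ S then x (⟨p.1, h⟩, p.2) else 0
  map_add' x y := by
    ext p
    by_cases h : p.1 ∈ S <;> simp [h]
  map_smul' c x := by
    ext p
    by_cases h : p.1 ∈ S <;> simp [h]

theorem extendBlocks_of_mem {S : Finset β} (x : {l // l ∈ S} × n → F) {p : β × n}
    (h : p.1 ∈ S) : extendBlocks S x p = x (⟨p.1, h⟩, p.2) := dif_pos h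

theorem extendBlocks_of_notMem {S : Finset β} (x : {l // l ∈ S} × n → F) {p : β × n}
    (h : p.1 ∉ S) : extendBlocks S x p = 0 := dif_neg h

theorem extendBlocks_mem_codeOf_blockMatrix [Fintype β] [Fintype n] {a b : Type*}
    {A : β → Matrix a n F} {B : β → Matrix b n F} {S : Finset β} {x : {l // l ∈ S} × n → F}
    (hx : x ∈ codeOf (blockMatrix (fun l : {l // l ∈ S} => A l) (fun l => B l))) :
    extendBlocks S x ∈ codeOf (blockMatrix A B) := by
  rw [mem_codeOf_blockMatrix] at hx ⊢
  refine ⟨fun l p => ?_, fun p => ?_⟩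
  · by_cases hl : l ∈ S
    · rw [← hx.1 ⟨l, hl⟩ p]
      exact Finset.sum_congr rfl fun j _ => by rw [extendBlocks_of_mem x (p := (l, j)) hl]
    · exact Finset.sum_eq_zero fun j _ => by
        rw [extendBlocks_of_notMem x (p := (l, j)) hl, mul_zero]
  · have h1 : ∀ l : {l // l ∈ S}, ∑ j, B l p j * x (l, j) =
        ∑ j, B l p j * extendBlocks S x ((l : β), j) := fun l =>
      Finset.sum_congr rfl fun j _ => by rw [extendBlocks_of_mem x (p := ((l : β), j)) l.2]
    rw [← hx.2 p, Finset.sum_congr rfl fun l _ => h1 l,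
      Finset.sum_coe_sort S fun l => ∑ j, B l p j * extendBlocks S x (l, j)]
    refine (Finset.sum_subset (Finset.subset_univ S) fun l _ hl => ?_).symm
    exact Finset.sum_eq_zero fun j _ => by
      rw [extendBlocks_of_notMem x (p := (l, j)) hl, mul_zero]

end ExtendBlocks

/-! ### The merge conversion and its optimality. -/

section MergeConstruction

open Module

variable {F : Type*} [Field F] {r δ s u t ℓ m : ℕ}

/-- `min u s * r` symbols of the common blocks determine all symbols of the common blocks. -/
theorem exists_read_set (hr : 1 ≤ r) (hδ : 1 ≤ δ) (hm : m = ℓ + s) (hℓ : ℓ = t * u) (i : Fin t)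
    {C : Submodule F (InitialIndex m u ℓ (r + δ - 1) i → F)} (hC : IsBlockGeneric C δ (s * r)) :
    ∃ R : Finset (InitialIndex m u ℓ (r + δ - 1) i), R.card = min u s * r ∧
      (∀ x ∈ R, (x.1 : Fin m) ∈ tail m ℓ) ∧
      ∀ c ∈ C, (∀ x ∈ R, c x = 0) → ∀ x, (x.1 : Fin m) ∈ tail m ℓ → c x = 0 := by
  obtain ⟨E, -, hE⟩ := Finset.exists_subset_card_eq
    (show δ - 1 ≤ (Finset.univ : Finset (Fin (r + δ - 1))).card by
      rw [Finset.card_univ, Fintype.card_fin]; omega)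
  have hEc : Eᶜ.card = r := by
    rw [Finset.card_compl, hE, Fintype.card_fin]
    omega
  set T : Finset (InitialIndex m u ℓ (r + δ - 1) i) :=
    (Finset.univ.filter fun l : {l // l ∈ group m u i ∪ tail m ℓ} => (l : Fin m) ∈ tail m ℓ) ×ˢ Eᶜ
    with hT
  have hTcard : T.card = s * r := by
    rw [hT, Finset.card_product, card_filter_mem_tail hm, hEc]
  have hTtail : ∀ x ∈ T, (x.1 : Fin m) ∈ tail m ℓ := fun x hx =>
    (Finset.mem_filter.1 (Finset.mem_product.1 hx).1).2
  rcases le_or_gt u s with hus | hus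
  -- For `u ≤ s`, any `u * r` of the tail symbols in `T` determine the whole codeword: outside `E`,
  -- only `s * r` positions are unknown.
  · obtain ⟨R, hRT, hR⟩ := Finset.exists_subset_card_eq
      ((Nat.mul_le_mul_right r hus).trans_eq hTcard.symm)
    refine ⟨R, by rw [hR, min_eq_left hus], fun x hx => hTtail x (hRT hx), fun c hc hcR x _ => ?_⟩
    rw [hC.eq_zero_of_card_sdiff_le hE R ?_ hc hcR]
    · rfl
    · rw [Finset.card_sdiff_of_subset (hRT.trans (Finset.product_subset_product_left
        (Finset.subset_univ _))), Finset.card_product, Finset.card_univ, Fintype.card_coe,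
        card_group_union_tail hm hℓ, hEc, hR, add_mul, Nat.add_sub_cancel_left]
  -- For `s < u`, it is cheaper to read `r` symbols of each tail block and use the local checks.
  · refine ⟨T, by rw [hTcard, min_eq_right hus.le], hTtail, fun c hc hcT x hx => ?_⟩
    refine hC.block_eq_zero c hc x.1 E (by omega) (fun j hj => hcT _ ?_) x.2
    exact Finset.mem_product.2 ⟨Finset.mem_filter.2 ⟨Finset.mem_univ _, hx⟩,
      Finset.mem_compl.2 hj⟩

/-- A codeword of an initial code is determined by its symbols in the group. -/
theorem eq_zero_of_eq_zero_on_group (hδ : 1 ≤ δ) (hr : 1 ≤ r) (hm : m = ℓ + s)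
    (hℓ : ℓ = t * u) (i : Fin t)
    {C : Submodule F (InitialIndex m u ℓ (r + δ - 1) i → F)} (hC : IsBlockGeneric C δ (s * r))
    {c : InitialIndex m u ℓ (r + δ - 1) i → F} (hc : c ∈ C)
    (h0 : ∀ x, (x.1 : Fin m) ∈ group m u i → c x = 0) : c = 0 := by
  obtain ⟨E, -, hE⟩ := Finset.exists_subset_card_eq
    (show δ - 1 ≤ (Finset.univ : Finset (Fin (r + δ - 1))).card by
      rw [Finset.card_univ, Fintype.card_fin]; omega)
  have hEc : Eᶜ.card = r := by
    rw [Finset.card_compl, hE, Fintype.card_fin]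
    omega
  refine hC.eq_zero_of_card_sdiff_le hE ((Finset.univ.filter
    fun l : {l // l ∈ group m u i ∪ tail m ℓ} => (l : Fin m) ∈ group m u i) ×ˢ Eᶜ) ?_ hc
    fun x hx => h0 x (Finset.mem_filter.1 (Finset.mem_product.1 hx).1).2
  rw [Finset.card_sdiff_of_subset (Finset.product_subset_product_left
    (Finset.subset_univ _)), Finset.card_product, Finset.card_product, Finset.card_univ,
    Fintype.card_coe, card_group_union_tail hm hℓ, hEc, card_filter_mem_group hm hℓ, add_mul,
    Nat.add_sub_cancel_left]

/-- The sum of the initial codewords, extended by zero. -/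
def mergeSum {n : ℕ} (c : ∀ i : Fin t, InitialIndex m u ℓ n i → F) : Fin m × Fin n → F :=
  ∑ i : Fin t, extendBlocks (group m u i ∪ tail m ℓ) (c i)

theorem mergeSum_apply_of_mem_tail {n : ℕ} (c : ∀ i : Fin t, InitialIndex m u ℓ n i → F)
    {p : Fin m × Fin n} (hp : p.1 ∈ tail m ℓ) :
    mergeSum c p = ∑ i, c i (⟨p.1, Finset.mem_union_right _ hp⟩, p.2) := by
  unfold mergeSum
  rw [Finset.sum_apply]
  exact Finset.sum_congr rfl fun i _ => extendBlocks_of_mem _ _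

theorem mergeSum_apply_of_mem_group (hℓ : ℓ = t * u) {n : ℕ}
    (c : ∀ i : Fin t, InitialIndex m u ℓ n i → F) {p : Fin m × Fin n} {i : Fin t}
    (hp : p.1 ∈ group m u i) :
    mergeSum c p = c i (⟨p.1, Finset.mem_union_left _ hp⟩, p.2) := by
  unfold mergeSum
  rw [Finset.sum_apply, Finset.sum_eq_single i]
  · exact extendBlocks_of_mem _ _
  · intro i' _ hi'
    refine extendBlocks_of_notMem _ fun h => ?_
    rcases Finset.mem_union.1 h with h | h
    · exact hi' (Fin.ext ((eq_div_of_mem_group h).trans (eq_div_of_mem_group hp).symm))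
    · exact notMem_tail_of_mem_group hℓ hp h
  · exact fun h => absurd (Finset.mem_univ _) h

variable {a b : ℕ} {A : Fin m → Matrix (Fin a) (Fin (r + δ - 1)) F}
  {B : Fin m → Matrix (Fin b) (Fin (r + δ - 1)) F}

variable (A B u ℓ) in
/-- The `i`-th initial code of the merge construction. -/
abbrev mergeInitial (i : ℕ) : Submodule F (InitialIndex m u ℓ (r + δ - 1) i → F) :=
  codeOf (blockMatrix (fun l : {l : Fin m // l ∈ group m u i ∪ tail m ℓ} => A l) (fun l => B l))

/-- The final code consists of the sums of the initial codewords, extended by zero. -/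
theorem mem_codeOf_iff_exists_mergeSum (hr : 1 ≤ r) (hδ : 1 ≤ δ) (hm : m = ℓ + s)
    (hℓ : ℓ = t * u)
    (hI : ∀ i : Fin t, IsBlockGeneric (mergeInitial (r := r) (δ := δ) u ℓ A B i) δ (s * r))
    (hrank : ∑ i : Fin t, finrank F (mergeInitial (r := r) (δ := δ) u ℓ A B i) =
      finrank F (codeOf (blockMatrix A B)))
    (v : Fin m × Fin (r + δ - 1) → F) :
    v ∈ codeOf (blockMatrix A B) ↔
      ∃ c : ∀ i : Fin t, InitialIndex m u ℓ (r + δ - 1) i → F,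
        (∀ i : Fin t, c i ∈ mergeInitial u ℓ A B i) ∧ v = mergeSum c := by
  have hmem : ∀ c : ∀ i : Fin t, InitialIndex m u ℓ (r + δ - 1) i → F,
      (∀ i : Fin t, c i ∈ mergeInitial u ℓ A B i) → mergeSum c ∈ codeOf (blockMatrix A B) := fun c hc =>
    Submodule.sum_mem _ fun i _ => extendBlocks_mem_codeOf_blockMatrix (hc i)
  refine ⟨fun hv => ?_, ?_⟩
  · let Ψ : (∀ i : Fin t, mergeInitial (r := r) (δ := δ) u ℓ A B i) →ₗ[F]
        codeOf (blockMatrix A B) := LinearMap.codRestrict _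
      (∑ i : Fin t, (extendBlocks (group m u i ∪ tail m ℓ)).comp
        ((mergeInitial (r := r) (δ := δ) u ℓ A B i).subtype.comp (LinearMap.proj i)))
      (fun c => by
        have := hmem (fun i => c i) fun i => (c i).2
        simpa [mergeSum] using this)
    have hΨ : ∀ c, (Ψ c : Fin m × Fin (r + δ - 1) → F) = mergeSum fun i => (c i).1 := by
      intro c
      simp [Ψ, mergeSum]
    have hinj : Function.Injective Ψ := by
      rw [← LinearMap.ker_eq_bot, LinearMap.ker_eq_bot']
      intro c hc
      have h0 : mergeSum (fun i => (c i).1) = 0 := by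
        rw [← hΨ, hc]
        rfl
      funext i
      refine Subtype.ext (eq_zero_of_eq_zero_on_group hδ hr hm hℓ i (hI i) (c i).2 ?_)
      rintro ⟨⟨l, hl⟩, j⟩ hx
      have := mergeSum_apply_of_mem_group hℓ (fun i => (c i).1) (p := (l, j)) hx
      rw [h0] at this
      exact this.symm
    -- Dimensions agree, so injectivity already gives every final codeword.
    have hsurj := (LinearMap.injective_iff_surjective_of_finrank_eq_finrank (f := Ψ) (by
      rw [finrank_pi_fintype, hrank])).1 hinj
    obtain ⟨c, hc⟩ := hsurj ⟨v, hv⟩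
    refine ⟨fun i => (c i).1, fun i => (c i).2, ?_⟩
    rw [← hΨ, hc]
  · rintro ⟨c, hc, rfl⟩
    exact hmem c hc

/-- The general construction yields an access-optimal convertible code of maximally recoverable
codes when the codes involved are generic. -/
theorem exists_isMergeConstruction (hr : 1 ≤ r) (hδ : 2 ≤ δ) (hu : 1 ≤ u) (ht : 1 ≤ t)
    (hm : m = ℓ + s) (hℓ : ℓ = t * u)
    (hF : IsBlockGeneric (codeOf (blockMatrix A B)) δ (s * r))
    (hI : ∀ i : Fin t, IsBlockGeneric (mergeInitial (r := r) (δ := δ) u ℓ A B i) δ (s * r)) :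
    ∃ 𝒞 : ConvertibleCode F (fun i : Fin t => InitialIndex m u ℓ (r + δ - 1) i)
        (Fin m × Fin (r + δ - 1)),
      IsMergeConstruction A B 𝒞 ∧
      𝒞.HasParameters ((u + s) * (r + δ - 1)) (u * r) r δ (m * (r + δ - 1)) (ℓ * r) r δ ∧
      IsAccessOptimal 𝒞 ((u + s) * (r + δ - 1)) (u * r) (m * (r + δ - 1)) r δ
        (singletonDefect r δ) ∧
      (∀ i, IsMRCode (𝒞.initial i) r (s * r) δ) ∧ IsMRCode 𝒞.final r (s * r) δ := by
  classical
  have hδ1 : 1 ≤ δ := by omega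
  have hm' : m = t * u + s := by rw [hm, hℓ]
  have hcardI : ∀ i : Fin t, Fintype.card {l // l ∈ group m u i ∪ tail m ℓ} = u + s := fun i => by
    rw [Fintype.card_coe, card_group_union_tail hm hℓ]
  have hsI : ∀ i : Fin t, s * r < Fintype.card {l // l ∈ group m u i ∪ tail m ℓ} * r := fun i => by
    rw [hcardI]
    exact Nat.mul_lt_mul_of_pos_right (by omega) hr
  have hℓ0 : 0 < ℓ := by
    rw [hℓ]
    exact Nat.mul_pos ht hu
  have hsF : s * r < Fintype.card (Fin m) * r := by
    rw [Fintype.card_fin]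
    exact Nat.mul_lt_mul_of_pos_right (by omega) hr
  have hrankI : ∀ i : Fin t, finrank F (mergeInitial (r := r) (δ := δ) u ℓ A B i) = u * r := by
    intro i
    have h1 : finrank F (mergeInitial (r := r) (δ := δ) u ℓ A B i) + s * r = u * r + s * r := by
      rw [← add_mul, ← hcardI i]
      exact (hI i).finrank_add_eq hr hδ1 (hsI i).le
    exact Nat.add_right_cancel h1
  have hrankF : finrank F (codeOf (blockMatrix A B)) = ℓ * r := by
    have h1 := hF.finrank_add_eq hr hδ1 hsF.le
    have h2 : Fintype.card (Fin m) * r = ℓ * r + s * r := by rw [Fintype.card_fin, hm, add_mul]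
    exact Nat.add_right_cancel (h1.trans h2)
  have hrank : ∑ i : Fin t, finrank F (mergeInitial (r := r) (δ := δ) u ℓ A B i) =
      finrank F (codeOf (blockMatrix A B)) := by
    rw [Finset.sum_congr rfl fun i _ => hrankI i, hrankF, hℓ]
    simp [mul_assoc]
  choose R hRcard hRtail hR using fun i : Fin t => exists_read_set hr hδ1 hm hℓ i (hI i)
  let U : ∀ i : Fin t, Finset (InitialIndex m u ℓ (r + δ - 1) i) := fun i =>
    Finset.univ.filter fun x => (x.1 : Fin m) ∈ group m u i
  have hU : ∀ i x, x ∈ U i ↔ (x.1 : Fin m) ∈ group m u i := fun i x => by simp [U]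
  let place : (Σ i, U i) ↪ Fin m × Fin (r + δ - 1) :=
    ⟨fun x => (x.2.1.1.1, x.2.1.2), by
      rintro ⟨i, ⟨⟨⟨l, hl⟩, j⟩, hx⟩⟩ ⟨i', ⟨⟨⟨l', hl'⟩, j'⟩, hx'⟩⟩ h
      obtain ⟨rfl, rfl⟩ := Prod.mk.inj h
      obtain rfl : i = i' := Fin.ext ((eq_div_of_mem_group ((hU _ _).1 hx)).trans
        (eq_div_of_mem_group ((hU _ _).1 hx')).symm)
      rfl⟩
  have hplace : ∀ w, w ∉ Set.range place → w.1 ∈ tail m ℓ := by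
    rintro ⟨l, j⟩ hw
    by_contra hl
    rw [mem_tail, not_le, hℓ] at hl
    have hlt : (l : ℕ) / u < t := Nat.div_lt_of_lt_mul (by rwa [mul_comm])
    have hg : l ∈ group m u ((⟨(l : ℕ) / u, hlt⟩ : Fin t) : ℕ) := mem_group_div hu l
    exact hw ⟨⟨⟨(l : ℕ) / u, hlt⟩, ⟨(⟨l, Finset.mem_union_left _ hg⟩, j), (hU _ _).2 hg⟩⟩, rfl⟩
  -- Any codeword agreeing with the read symbols will do, since only its tail is used and the tail
  -- is determined; inconsistent input gets the value `0`.
  let dec : ∀ i : Fin t, (R i → F) → (InitialIndex m u ℓ (r + δ - 1) i → F) := fun i y =>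
    if h : ∃ c ∈ mergeInitial (r := r) (δ := δ) u ℓ A B i, ∀ x : R i, c x = y x
    then h.choose else 0
  have hdec : ∀ i : Fin t, ∀ c ∈ mergeInitial (r := r) (δ := δ) u ℓ A B i,
      ∀ x, (x.1 : Fin m) ∈ tail m ℓ → dec i (fun y => c y) x = c x := by
    intro i c hc x hx
    have h : ∃ c' ∈ mergeInitial (r := r) (δ := δ) u ℓ A B i, ∀ x : R i, c' x = c x :=
      ⟨c, hc, fun _ => rfl⟩
    have h1 : dec i (fun y => c y) = h.choose := dif_pos h
    rw [h1, ← sub_eq_zero]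
    exact hR i (h.choose - c) (Submodule.sub_mem _ h.choose_spec.1 hc) (fun y hy =>
      sub_eq_zero.2 (h.choose_spec.2 ⟨y, hy⟩)) x hx
  let conv : (∀ i, R i → F) → ({w : Fin m × Fin (r + δ - 1) // w ∉ Set.range place} → F) :=
    fun y w => ∑ i, dec i (y i) (⟨w.1.1, Finset.mem_union_right _ (hplace w.1 w.2)⟩, w.1.2)
  have hconv : ∀ c : ∀ i : Fin t, InitialIndex m u ℓ (r + δ - 1) i → F,
      (∀ i : Fin t, c i ∈ mergeInitial (r := r) (δ := δ) u ℓ A B i) →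
      ∀ w : {w // w ∉ Set.range place}, conv (fun i x => c i x) w =
        ∑ i, c i (⟨w.1.1, Finset.mem_union_right _ (hplace w.1 w.2)⟩, w.1.2) := fun c hc w =>
    Finset.sum_congr rfl fun i _ => hdec i (c i) (hc i) _ (hplace w.1 w.2)
  let 𝒞 : ConvertibleCode F (fun i : Fin t => InitialIndex m u ℓ (r + δ - 1) i)
      (Fin m × Fin (r + δ - 1)) :=
    { initial := fun i => mergeInitial u ℓ A B i
      final := codeOf (blockMatrix A B)
      finrank_eq := hrank
      unchanged := U
      read := R
      place := place
      convert := conv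
      mem_final_iff := fun v => by
        rw [mem_codeOf_iff_exists_mergeSum hr hδ1 hm hℓ hI hrank]
        refine exists_congr fun c => and_congr_right fun hc => ?_
        constructor
        · rintro rfl
          refine ⟨?_, fun w => ?_⟩
          · rintro ⟨i, ⟨⟨⟨l, hl⟩, j⟩, hx⟩⟩
            exact mergeSum_apply_of_mem_group hℓ c (p := (l, j)) ((hU _ _).1 hx)
          · rw [hconv c hc]
            exact mergeSum_apply_of_mem_tail c (hplace w.1 w.2)
        · rintro ⟨h1, h2⟩
          funext w
          by_cases hw : w ∈ Set.range place
          · obtain ⟨⟨i, ⟨⟨⟨l, hl⟩, j⟩, hx⟩⟩, rfl⟩ := hw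
            rw [h1]
            exact (mergeSum_apply_of_mem_group hℓ c (p := (l, j)) ((hU _ _).1 hx)).symm
          · rw [h2 ⟨w, hw⟩, hconv c hc]
            exact (mergeSum_apply_of_mem_tail c (hplace w hw)).symm }
  have hnF : Fintype.card (Fin m × Fin (r + δ - 1)) = m * (r + δ - 1) := by simp
  have hrankF' : finrank F (codeOf (blockMatrix A B)) = t * (u * r) := by
    rw [hrankF, hℓ, mul_assoc]
  have hdist := distance_mergeConstruction hr hδ1 hm'
  obtain ⟨hmin, hopt⟩ := minDist_eq_and_dOpt_eq hr hδ1 hnF hrankF'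
    (Nat.mul_pos ht (Nat.mul_pos hu hr)) hF.hasLocality (hF.le_minDist hδ1 rfl) hdist
  refine ⟨𝒞, ?_, ?_, ?_, fun i => (hI i).isMRCode hr hδ1 (hsI i), hF.isMRCode hr hδ1 hsF⟩
  · exact
      { initial_eq := fun _ => rfl
        final_eq := rfl
        unchanged_eq := hU
        place_eq := fun _ => rfl
        read_subset := hRtail
        convert_eq := fun c hc w _ => hconv c hc w }
  · exact
      { card_initial := fun i => by
          rw [Fintype.card_prod, hcardI, Fintype.card_fin]
        finrank_initial := hrankI
        locality_initial := fun i => (hI i).hasLocality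
        card_final := hnF
        finrank_final := hrankF
        locality_final := hF.hasLocality }
  · refine ⟨isDistanceDefect_singletonDefect hr hδ1 hopt hdist, _, hmin, hopt, ?_, ?_⟩
    · rw [readBound_mergeConstruction hr hδ ht hu hm']
      change ∑ i, ((R i).card : ℤ) = _
      rw [Finset.sum_congr rfl fun i _ => by rw [hRcard i]]
      simp
    · rw [writeBound_mergeConstruction hr hδ1 ht hm']
      have hUcard : ∀ i, (U i).card = u * (r + δ - 1) := fun i => by
        have : U i = (Finset.univ.filter fun l : {l // l ∈ group m u i ∪ tail m ℓ} =>
            (l : Fin m) ∈ group m u i) ×ˢ Finset.univ := by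
          ext x
          rw [hU, Finset.mem_product, Finset.mem_filter]
          simp
        rw [this, Finset.card_product, card_filter_mem_group hm hℓ, Finset.card_univ,
          Fintype.card_fin]
      change (Fintype.card (Fin m × Fin (r + δ - 1)) : ℤ) - ∑ i, ((U i).card : ℤ) = _
      rw [Finset.sum_congr rfl fun i _ => by rw [hUcard i], hnF]
      simp only [Finset.sum_const, Finset.card_univ, Fintype.card_fin, nsmul_eq_mul]
      rw [hm']
      push_cast
      ring

end MergeConstruction

end LRCC

theorem theorem5 {K L : Type*} [Field K] [Finite K] [Field L] [Algebra K L]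
    (q r δ h m u : ℕ) (hq : Nat.card K = q)
    (hr : 1 ≤ r) (hδ : 2 ≤ δ) (hu : 1 ≤ u)
    (hqm : max (r + δ) (m + 1) ≤ q)
    (hrh : r ∣ h) (hdim : h / r < m) (hum : u ∣ m - h / r)
    (α : Fin (r + δ - 1) → K) (hα : Function.Injective α) (hα0 : ∀ j, α j ≠ 0)
    (b : Module.Basis (Fin h) K L)
    (γ : L) (hγ : IsPrimitiveRoot γ (q ^ h - 1)) :
    ∃ 𝒞 : LRCC.ConvertibleCode L
        (fun i : Fin ((m - h / r) / u) =>
          LRCC.InitialIndex m u (m - h / r) (r + δ - 1) i)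
        (Fin m × Fin (r + δ - 1)),
      LRCC.IsMergeConstruction
        (fun _ => LRCC.baseP L δ α)
        (fun l => LRCC.baseD q h (γ ^ (l : ℕ)) (LRCC.baseBeta δ α b)) 𝒞 ∧
      𝒞.HasParameters
        ((u + h / r) * (r + δ - 1)) (u * r) r δ
        (m * (r + δ - 1)) ((m - h / r) * r) r δ ∧
      LRCC.IsAccessOptimal 𝒞
        ((u + h / r) * (r + δ - 1)) (u * r) (m * (r + δ - 1)) r δ
        (LRCC.singletonDefect r δ) ∧
      (∀ i, LRCC.IsMRCode (𝒞.initial i) r h δ) ∧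
      LRCC.IsMRCode 𝒞.final r h δ := by
  have : Module.Finite K L := Module.Finite.of_basis b
  have : Finite L := Module.finite_of_finite K
  have hL : Nat.card L = q ^ h := by
    rw [Module.natCard_eq_pow_finrank (K := K), hq, Module.finrank_eq_card_basis b,
      Fintype.card_fin]
  have hq1 : 1 < q := by
    rw [← hq]
    exact Finite.one_lt_card
  -- For `h = 0` the field `L` would have only one element.
  have hh : h ≠ 0 := by
    rintro rfl
    have := Finite.one_lt_card (α := L)
    rw [hL, pow_zero] at this
    exact this.false
  -- There are `q - 1` classes of nonzero elements under conjugacy; this keeps the exponents `l < m`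
  -- in different ones.
  have hmq : m ≤ q - 1 := by
    have := (le_max_right _ _).trans hqm
    omega
  have hγ0 : γ ≠ 0 := hγ.ne_zero (by
    have := Nat.one_lt_pow hh hq1
    omega)
  subst hq
  have hconj : ∀ l l' : Fin m, ∀ x y : L, x ≠ 0 → y ≠ 0 →
      γ ^ (l : ℕ) * x ^ (Nat.card K - 1) = γ ^ (l' : ℕ) * y ^ (Nat.card K - 1) → l = l' :=
    fun l l' x y hx hy hxy => Fin.ext (LRCC.eq_of_pow_mul_pow_eq_pow_mul_pow hL hq1 hh hγ
      (l.2.trans_le hmq) (l'.2.trans_le hmq) hx hy hxy)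
  have hsr : h / r * r = h := Nat.div_mul_cancel hrh
  have hF := LRCC.isBlockGeneric_baseCode b hα hδ (a := fun l : Fin m => γ ^ (l : ℕ))
    (fun _ => pow_ne_zero _ hγ0) hconj
  -- An initial code is a base code on fewer blocks, so the separation of conjugacy classes is
  -- inherited.
  have hI := fun i : Fin ((m - h / r) / u) => LRCC.isBlockGeneric_baseCode b hα hδ
    (a := fun l : {l : Fin m // l ∈ LRCC.group m u i ∪ LRCC.tail m (m - h / r)} =>
      γ ^ ((l : Fin m) : ℕ))
    (fun _ => pow_ne_zero _ hγ0)
    (fun l l' x y hx hy hxy => Subtype.ext (hconj l l' x y hx hy hxy))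
  have key := LRCC.exists_isMergeConstruction (s := h / r) (t := (m - h / r) / u) hr hδ hu
    (Nat.div_pos (Nat.le_of_dvd (by omega) hum) hu) (ℓ := m - h / r) (m := m) (by omega)
    (Nat.div_mul_cancel hum).symm (A := fun _ => LRCC.baseP L δ α)
    (B := fun l => LRCC.baseD (Nat.card K) h (γ ^ (l : ℕ)) (LRCC.baseBeta δ α b))
  rw [hsr] at key
  exact key hF hI
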